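/- **Setting.** A *QPath diagram* $d : m \to n$ ($m,n\in\mathbb N$) is a term built by sequential composition ($;$, read left to right) and parallel composition ($\otimes$) from identities, wire permutations, and the generators $\delta:1\to2$, $\epsilon:1\to0$, $\mu:2\to1$, $\eta:0\to1$, $r:1\to1$ ($r\in\mathbb C$), the creation $|n\rangle:0\to1$ and the annihilation $\langle n|:1\to0$ of $n\ge1$ photons. Diagrams are rewritten inside formal $\mathbb C$-linear combinations of diagrams (on which both compositions are bilinear) by the congruence, compatible with linear combinations and both compositions, generated by the following axioms: * *Path axioms*: the axioms of a PROP (strict symmetric monoidal category with objects $\mathbb N$); $(\mu,\eta,\delta,\epsilon)$ is a commutative and cocommutative bialgebra; every $r$ is a bialgebra homomorphism, $r;s=rs$, the endomorphism $1$ is the identity, $\delta;(r\otimes s);\mu=r+s$, and the endomorphism $0$ is $\epsilon;\eta$; * *normalisation*: $|n\rangle=\frac1{\sqrt{n!}}\,|1\rangle^{\otimes n};\mu_n$ and $\langle n|=\frac1{\sqrt{n!}}\,\delta_n;\langle1|^{\otimes n}$, where $\mu_n:n\to1$ and $\delta_n:1\to n$ are the $n$-fold (co)multiplications; * *branching*: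 $|1\rangle;\delta=|1\rangle\otimes\eta+\eta\otimes|1\rangle$ and $\mu;\langle1|=\langle1|\otimes\epsilon+\epsilon\otimes\langle1|$; * *scalar laws*: $|1\rangle;\epsilon=0$, $\eta;\langle1|=0$, and $|1\rangle;r;\langle1|=r\cdot\mathrm{id}_0$. The *bosonic interpretation* $\mathcal B$ sends $m$ wires to the bosonic Fock space on $m$ modes with orthonormal basis $|s_1,\dots,s_m\rangle$, $s_i\in\mathbb N$. It sends the diagrams to linear maps on the dense subspace of finite linear combinations of basis states (on all of $\ell^2(\mathbb N^m)$ these operators are in general unbounded). It sends $;$ to composition, $\otimes$ to the tensor product, permutations to permutations of modes, and $$\mathcal B(\delta)|n\rangle=\sum_{k=0}^n\binom nk^{1/2}|k,n-k\rangle,\quad \mathcal B(\mu)=\mathcal B(\delta)^\dagger,\quad \mathcal B(\eta)=|0\rangle,\quad \mathcal B(\epsilon)=\langle0|,\quad \mathcal B(r)|n\rangle=r^n|n\rangle,$$ and creation and annihilation of $n$ photons to $|n\rangle$ and $\langle n|$. It is extended linearly to formal sums. A closed diagram $d:0\to0$ is interpreted as a complex number $\mathcal B(d)$. A *weighted bipartite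 graph* $G$ has node classes of sizes $p$ and $q$, edges between the two classes, and a weight $w_e\in\mathbb C$ on each edge $e$. It is drawn as a closed diagram $D(G)$: $p$ preparations of one photon, each copied along its edges; each edge carrying its weight; the edges at each node of the second class merged and annihilated by $\langle1|$. A pair $(G,N)$ with $N\in\mathbb C$ is a *normal form* of a closed diagram $d$ if $d$ can be rewritten to $N\cdot D(G)$ with the Path axioms and the normalisation law only. **Theorem (Completeness).** 1. The rewrite rules of QPath are sound for $\mathcal B$. For closed diagrams $d,d':0\to0$ they are complete: if $\mathcal B(d)=\mathcal B(d')$, then $d$ can be rewritten to $d'$. The same holds for formal sums of closed diagrams. 2. Every closed diagram $d$ has a normal form $(G_d,N_d)$ in which $N_d$ is the product of the factors $1/\sqrt{n!}$ over all creations and annihilations of $n$ photons in $d$. 3. For every closed diagram $d$ and every normal form $(G_d,N_d)$ of $d$, $$\mathcal B(d)=N_d\sum_M\prod_{e\in M}w_e ,$$ where $M$ ranges over the perfect matchings of $G_d$ (sets of edges such that every node lies in exactly one of them). If $p=q$ this is $N_d$ times the permanent of the $p\times q$ adjacency matrix of weights of $G_d$ (with respect to any identification of its row and column indices), and if $p\ne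 q$ it is $0$. -/

import Mathlib

noncomputable section

namespace QPath

/-! ### Diagrams -/

/-- Diagrams `m → n` of the QPath calculus: the terms generated, under sequential composition
`seq` (read from left to right) and parallel composition `par`, by the structure of a PROP
(identities and symmetries), by the generators of Path over `ℂ`, and by photon creation and
annihilation. The symmetry on one pair of wires is `swap 1 1`. -/
inductive Diag : ℕ → ℕ → Type
  | idn (n : ℕ) : Diag n n
  | seq {l m n : ℕ} (f : Diag l m) (g : Diag m n) : Diag l n
  | par {m n m' n' : ℕ} (f : Diag m n) (g : Diag m' n') : Diag (m + m') (n + n')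
  | swap (m n : ℕ) : Diag (m + n) (n + m)
  | copy : Diag 1 2
  | discard : Diag 1 0
  | merge : Diag 2 1
  | unit : Diag 0 1
  | endo (r : ℂ) : Diag 1 1
  | create (n : ℕ+) : Diag 0 1
  | annihilate (n : ℕ+) : Diag 1 0

namespace Diag

/-- Transport along equalities of the numbers of wires. -/
def cast {m n m' n' : ℕ} (hm : m = m') (hn : n = n') (d : Diag m n) : Diag m' n' :=
  hm ▸ hn ▸ d

/-- The `n`-fold comonoid `1 → n`. -/
def copyN : (n : ℕ) → Diag 1 n
  | 0 => discard
  | n + 1 => copy.seq ((copyN n).par (idn 1))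

/-- The `n`-fold monoid `n → 1`. -/
def mergeN : (n : ℕ) → Diag n 1
  | 0 => unit
  | n + 1 => Diag.seq (m := 1 + 1) ((mergeN n).par (idn 1)) merge

/-- `n` empty modes `0 → n`. -/
def units : (n : ℕ) → Diag 0 n
  | 0 => idn 0
  | n + 1 => (units n).par unit

/-- `n` modes, each prepared with one photon. -/
def creates : (n : ℕ) → Diag 0 n
  | 0 => idn 0
  | n + 1 => (creates n).par (create 1)

/-- `n` modes, each post-selected on one photon. -/
def annihilates : (n : ℕ) → Diag n 0
  | 0 => idn 0
  | n + 1 => (annihilates n).par (annihilate 1)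

/-- The parallel composition of `n` one-wire diagrams. -/
def parN : (n : ℕ) → (Fin n → Diag 1 1) → Diag n n
  | 0, _ => idn 0
  | n + 1, f => (parN n fun i => f i.castSucc).par (f (Fin.last n))

/-- The monoid applied wire by wire to two bundles of `n` wires. -/
def mergeBundle : (n : ℕ) → Diag (n + n) n
  | 0 => idn 0
  | n + 1 =>
    Diag.seq (m := (n + n) + (1 + 1))
      (Diag.cast (m' := (n + 1) + (n + 1)) (n' := (n + n) + (1 + 1)) (by omega) (by omega)
        (((idn n).par (swap 1 n)).par (idn 1)))
      ((mergeBundle n).par merge)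

/-- The bipartite diagram `p → q` in which the input `i` is copied to all outputs, the wire
from `i` to `j` carries the one-wire diagram `f i j`, and the wires arriving at an output are
merged. -/
def wires : (p q : ℕ) → (Fin p → Fin q → Diag 1 1) → Diag p q
  | 0, q, _ => units q
  | p + 1, q, f =>
    ((wires p q fun i => f i.castSucc).par ((copyN q).seq (parN q (f (Fin.last p))))).seq
      (mergeBundle q)

/-- The product of the factors `1 / √(n!)` over all the creations and annihilations of `n`
photons in a diagram. -/
def normFactor : {m n : ℕ} → Diag m n → ℂ
  | _, _, seq f g => normFactor f * normFactor g
  | _, _, par f g => normFactor f * normFactor g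
  | _, _, create n => 1 / (Real.sqrt (Nat.factorial n) : ℂ)
  | _, _, annihilate n => 1 / (Real.sqrt (Nat.factorial n) : ℂ)
  | _, _, idn _ => 1
  | _, _, swap _ _ => 1
  | _, _, copy => 1
  | _, _, discard => 1
  | _, _, merge => 1
  | _, _, unit => 1
  | _, _, endo _ => 1

end Diag

open Diag

/-! ### Formal sums of diagrams -/

/-- Formal `ℂ`-linear combinations of diagrams `m → n`. -/
abbrev Lin (m n : ℕ) : Type := Diag m n →₀ ℂ

/-- A diagram as a formal sum. -/
def Lin.of {m n : ℕ} (d : Diag m n) : Lin m n := Finsupp.single d 1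

/-- Sequential composition, extended bilinearly. -/
def Lin.seq {l m n : ℕ} (x : Lin l m) (y : Lin m n) : Lin l n :=
  x.sum fun d a => y.sum fun e b => Finsupp.single (Diag.seq d e) (a * b)

/-- Parallel composition, extended bilinearly. -/
def Lin.par {m n m' n' : ℕ} (x : Lin m n) (y : Lin m' n') : Lin (m + m') (n + n') :=
  x.sum fun d a => y.sum fun e b => Finsupp.single (Diag.par d e) (a * b)

/-! ### Axioms and rewriting -/

/-- The axioms of the Path calculus: those of a PROP (a strict symmetric monoidal category with
objects the natural numbers), those of a commutative and cocommutative bialgebra, and those of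
the endomorphisms `endo r`, which are bialgebra homomorphisms carrying the semiring structure
of `ℂ`. -/
inductive PathAxiom : {m n : ℕ} → Diag m n → Diag m n → Prop
  -- PROP structure
  | id_seq {m n : ℕ} (f : Diag m n) : PathAxiom ((idn m).seq f) f
  | seq_id {m n : ℕ} (f : Diag m n) : PathAxiom (f.seq (idn n)) f
  | seq_assoc {k l m n : ℕ} (f : Diag k l) (g : Diag l m) (h : Diag m n) :
      PathAxiom ((f.seq g).seq h) (f.seq (g.seq h))
  | par_id (m n : ℕ) : PathAxiom ((idn m).par (idn n)) (idn (m + n))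
  | interchange {l m n l' m' n' : ℕ} (f : Diag l m) (g : Diag m n) (f' : Diag l' m')
      (g' : Diag m' n') :
      PathAxiom ((f.seq g).par (f'.seq g')) ((f.par f').seq (g.par g'))
  | empty_par {m n : ℕ} (f : Diag m n) :
      PathAxiom (Diag.cast (Nat.zero_add m) (Nat.zero_add n) ((idn 0).par f)) f
  | par_empty {m n : ℕ} (f : Diag m n) : PathAxiom (f.par (idn 0)) f
  | par_assoc {m n m' n' m'' n'' : ℕ} (f : Diag m n) (g : Diag m' n') (h : Diag m'' n'') :
      PathAxiom (Diag.cast (Nat.add_assoc m m' m'') (Nat.add_assoc n n' n'') ((f.par g).par h))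
        (f.par (g.par h))
  | swap_natural {m n m' n' : ℕ} (f : Diag m n) (g : Diag m' n') :
      PathAxiom ((f.par g).seq (swap n n')) ((swap m m').seq (g.par f))
  | swap_swap (m n : ℕ) : PathAxiom ((swap m n).seq (swap n m)) (idn (m + n))
  | swap_zero (m : ℕ) : PathAxiom (Diag.cast rfl (Nat.zero_add m) (swap m 0)) (idn m)
  | swap_add (m n k : ℕ) :
      PathAxiom (swap m (n + k))
        (Diag.seq (m := n + (m + k))
          (Diag.cast (Nat.add_assoc m n k) (Nat.add_assoc n m k) ((swap m n).par (idn k)))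
          (Diag.cast rfl (Nat.add_assoc n k m).symm ((idn n).par (swap m k))))
  -- commutative comonoid
  | copy_assoc : PathAxiom (copy.seq (copy.par (idn 1))) (copy.seq ((idn 1).par copy))
  | copy_comm : PathAxiom (copy.seq (swap 1 1)) copy
  | copy_discard : PathAxiom (copy.seq (discard.par (idn 1))) (idn 1)
  -- commutative monoid
  | merge_assoc : PathAxiom ((merge.par (idn 1)).seq merge)
      (Diag.seq (l := 3) (m := 1 + 1) ((idn 1).par merge) merge)
  | merge_comm : PathAxiom ((swap 1 1).seq merge) merge
  | merge_unit : PathAxiom (Diag.seq (l := 1) (m := 1 + 1) (unit.par (idn 1)) merge) (idn 1)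
  -- bialgebra
  | merge_copy : PathAxiom (merge.seq copy)
      (Diag.seq (m := 4) (copy.par copy)
        (Diag.seq (m := 4) (((idn 1).par (swap 1 1)).par (idn 1)) (merge.par merge)))
  | unit_copy : PathAxiom (unit.seq copy) (unit.par unit)
  | merge_discard : PathAxiom (merge.seq discard) (discard.par discard)
  | unit_discard : PathAxiom (unit.seq discard) (idn 0)
  -- endomorphisms
  | endo_mul (r s : ℂ) : PathAxiom ((endo r).seq (endo s)) (endo (r * s))
  | endo_one : PathAxiom (endo 1) (idn 1)
  | endo_add (r s : ℂ) :
      PathAxiom (copy.seq (Diag.seq (m := 1 + 1) ((endo r).par (endo s)) merge)) (endo (r + s))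
  | endo_zero : PathAxiom (endo 0) (discard.seq unit)
  | endo_copy (r : ℂ) : PathAxiom ((endo r).seq copy) (copy.seq ((endo r).par (endo r)))
  | endo_discard (r : ℂ) : PathAxiom ((endo r).seq discard) discard
  | merge_endo (r : ℂ) :
      PathAxiom (merge.seq (endo r)) (Diag.seq (m := 1 + 1) ((endo r).par (endo r)) merge)
  | unit_endo (r : ℂ) : PathAxiom (unit.seq (endo r)) unit

/-- The axioms of Path together with the normalisation law. -/
inductive NormAxiom : {m n : ℕ} → Lin m n → Lin m n → Prop
  | path {m n : ℕ} {d e : Diag m n} (h : PathAxiom d e) : NormAxiom (Lin.of d) (Lin.of e)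
  | create_norm (n : ℕ+) : NormAxiom (Lin.of (create n))
      ((1 / (Real.sqrt (Nat.factorial n) : ℂ)) • Lin.of ((creates n).seq (mergeN n)))
  | annihilate_norm (n : ℕ+) : NormAxiom (Lin.of (annihilate n))
      ((1 / (Real.sqrt (Nat.factorial n) : ℂ)) • Lin.of ((copyN n).seq (annihilates n)))

/-- The axioms of QPath: those of Path, and the normalisation, branching and scalar laws. -/
inductive QPathAxiom : {m n : ℕ} → Lin m n → Lin m n → Prop
  | norm {m n : ℕ} {x y : Lin m n} (h : NormAxiom x y) : QPathAxiom x y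
  -- branching: a photon entering a copy leaves through one of its two legs
  | create_branch : QPathAxiom (Lin.of ((create 1).seq copy))
      (Lin.of ((create 1).par unit) + Lin.of (unit.par (create 1)))
  | annihilate_branch : QPathAxiom (Lin.of (merge.seq (annihilate 1)))
      (Lin.of ((annihilate 1).par discard) + Lin.of (discard.par (annihilate 1)))
  -- scalars
  | create_discard : QPathAxiom (Lin.of ((create 1).seq discard)) 0
  | unit_annihilate : QPathAxiom (Lin.of (unit.seq (annihilate 1))) 0
  | scalar (r : ℂ) : QPathAxiom (Lin.of ((create 1).seq ((endo r).seq (annihilate 1))))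
      (r • Lin.of (idn 0))

/-- Rewriting with a set `ax` of axioms, each usable in both directions and inside any diagram:
the congruence generated by `ax` on formal sums of diagrams. -/
inductive Rewrites (ax : ∀ m n : ℕ, Lin m n → Lin m n → Prop) :
    {m n : ℕ} → Lin m n → Lin m n → Prop
  | rule {m n : ℕ} {x y : Lin m n} (h : ax m n x y) : Rewrites ax x y
  | refl {m n : ℕ} (x : Lin m n) : Rewrites ax x x
  | symm {m n : ℕ} {x y : Lin m n} (h : Rewrites ax x y) : Rewrites ax y x
  | trans {m n : ℕ} {x y z : Lin m n} (h : Rewrites ax x y) (k : Rewrites ax y z) :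
      Rewrites ax x z
  | add {m n : ℕ} {x y x' y' : Lin m n} (h : Rewrites ax x y) (k : Rewrites ax x' y') :
      Rewrites ax (x + x') (y + y')
  | smul {m n : ℕ} {x y : Lin m n} (c : ℂ) (h : Rewrites ax x y) : Rewrites ax (c • x) (c • y)
  | seq {l m n : ℕ} {x y : Lin l m} {x' y' : Lin m n} (h : Rewrites ax x y)
      (k : Rewrites ax x' y') : Rewrites ax (x.seq x') (y.seq y')
  | par {m n m' n' : ℕ} {x y : Lin m n} {x' y' : Lin m' n'} (h : Rewrites ax x y)
      (k : Rewrites ax x' y') : Rewrites ax (x.par x') (y.par y')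

/-! ### The bosonic interpretation -/

/-- The bosonic Fock space on `m` modes: finite linear combinations of the occupation number
states `|s₁, …, sₘ⟩`. This is the dense subspace of `ℓ²(ℕ)^{⊗ m} = ℓ²(ℕ^m)` on which the
(in general unbounded) operators that interpret the generators are defined; all of them map
such combinations to such combinations. -/
abbrev Fock (m : ℕ) : Type := (Fin m → ℕ) →₀ ℂ

/-- The basis state with occupation numbers `s`. -/
def ket {m : ℕ} (s : Fin m → ℕ) : Fock m := Finsupp.single s 1

/-- The linear map with prescribed values on the basis states. -/
def ofKets {m n : ℕ} (v : (Fin m → ℕ) → Fock n) : Fock m →ₗ[ℂ] Fock n :=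
  Finsupp.linearCombination ℂ v

/-- The tensor product of two vectors, `|s⟩ ⊗ |t⟩ = |s, t⟩`. -/
def tensorVec {m n : ℕ} (x : Fock m) (y : Fock n) : Fock (m + n) :=
  x.sum fun s a => y.sum fun t b => Finsupp.single (Fin.append s t) (a * b)

/-- The tensor product of two linear maps, `|s, t⟩ ↦ f |s⟩ ⊗ g |t⟩`. -/
def tensorMap {m n m' n' : ℕ} (f : Fock m →ₗ[ℂ] Fock n) (g : Fock m' →ₗ[ℂ] Fock n') :
    Fock (m + m') →ₗ[ℂ] Fock (n + n') :=
  ofKets fun s => tensorVec (f (ket fun i => s (Fin.castAdd m' i)))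
    (g (ket fun i => s (Fin.natAdd m i)))

/-- The bosonic interpretation of diagrams. -/
def bosonic : {m n : ℕ} → Diag m n → (Fock m →ₗ[ℂ] Fock n)
  | _, _, idn _ => LinearMap.id
  | _, _, seq f g => bosonic g ∘ₗ bosonic f
  | _, _, par f g => tensorMap (bosonic f) (bosonic g)
  | _, _, swap m n => ofKets fun s =>
      ket (Fin.append (fun j => s (Fin.natAdd m j)) (fun i => s (Fin.castAdd n i)))
  | _, _, copy => ofKets fun s =>
      ∑ k ∈ Finset.range (s 0 + 1), (Real.sqrt ((s 0).choose k) : ℂ) • ket ![k, s 0 - k]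
  | _, _, merge => ofKets fun s =>
      (Real.sqrt ((s 0 + s 1).choose (s 0)) : ℂ) • ket ![s 0 + s 1]
  | _, _, .discard => ofKets fun s => if s 0 = 0 then ket ![] else 0
  | _, _, unit => ofKets fun _ => ket ![0]
  | _, _, endo r => ofKets fun s => r ^ s 0 • ket s
  | _, _, create n => ofKets fun _ => ket ![(n : ℕ)]
  | _, _, annihilate n => ofKets fun s => if s 0 = n then ket ![] else 0

/-- The bosonic interpretation of formal sums. -/
def bosonicLin {m n : ℕ} : Lin m n →ₗ[ℂ] (Fock m →ₗ[ℂ] Fock n) :=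
  Finsupp.linearCombination ℂ bosonic

/-- The complex number `⟨ |B(d)| ⟩` to which a closed diagram `d` is interpreted, under the
identification of linear maps `ℂ → ℂ` with complex numbers. -/
def amplitude (d : Diag 0 0) : ℂ := bosonic d (ket ![]) ![]

/-! ### Weighted bipartite graphs and perfect matchings -/

/-- An undirected bipartite graph with complex edge weights; its two classes of nodes are
`Fin p` (photon preparations) and `Fin q` (photon annihilations). -/
structure WeightedBipartiteGraph (p q : ℕ) where
  graph : SimpleGraph (Fin p ⊕ Fin q)
  bipartite : graph ≤ completeBipartiteGraph (Fin p) (Fin q)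
  weight : graph.edgeSet → ℂ

namespace WeightedBipartiteGraph

variable {p q : ℕ} (G : WeightedBipartiteGraph p q)

open Classical in
/-- The `p × q` (bi)adjacency matrix of weights. -/
def adjacency : Matrix (Fin p) (Fin q) ℂ := fun i j =>
  if h : G.graph.Adj (Sum.inl i) (Sum.inr j) then
    G.weight ⟨s(Sum.inl i, Sum.inr j), (SimpleGraph.mem_edgeSet G.graph).mpr h⟩
  else 0

open Classical in
/-- The closed diagram drawn by the graph: each node of `Fin p` is the preparation of one
photon, each node of `Fin q` is the annihilation of one photon, and each edge is a wire that
carries its weight. A pair of nodes without an edge is disconnected. -/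
def diagram : Diag 0 0 :=
  (creates p).seq
    ((wires p q fun i j =>
      if h : G.graph.Adj (Sum.inl i) (Sum.inr j) then
        endo (G.weight ⟨s(Sum.inl i, Sum.inr j), (SimpleGraph.mem_edgeSet G.graph).mpr h⟩)
      else discard.seq unit).seq
      (annihilates q))

/-- A set of edges is a perfect matching if every node lies in exactly one of them. -/
def IsPerfectMatching (M : Finset G.graph.edgeSet) : Prop :=
  ∀ v : Fin p ⊕ Fin q, ∃! e : G.graph.edgeSet, e ∈ M ∧ v ∈ (e : Sym2 (Fin p ⊕ Fin q))

open Classical in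
/-- The sum over the perfect matchings of the product of the weights of their edges. -/
def matchingSum : ℂ :=
  ∑ M : Finset G.graph.edgeSet with G.IsPerfectMatching M, ∏ e ∈ M, G.weight e

end WeightedBipartiteGraph

/-- The closed diagram `d` reduces to the graph `G` with normalisation factor `N`, using only
the axioms of Path and the normalisation law. -/
def IsNormalForm (d : Diag 0 0) {p q : ℕ} (G : WeightedBipartiteGraph p q) (N : ℂ) : Prop :=
  Rewrites @NormAxiom (Lin.of d) (N • Lin.of G.diagram)

end QPath

end

/-!
In the Bargmann representation, in which `|s⟩` is the monomial `∏ Xᵢ ^ sᵢ / √sᵢ!`, a diagram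
without photons acts by a linear substitution of variables, that is, by second quantisation of a
matrix. The Path axioms therefore reduce to identities of matrices, and the amplitude of `D(G)` is
the coefficient of `X₁ ⋯ X_q` in a product of `p` linear forms, a sum over the bijections between
the two node classes.

A diagram is brought to normal form from right to left: all preparations of photons are moved to
the front and all annihilations to the back. Every remaining generator turns a bipartite diagram of
weighted wires into another one, since the wires form a bialgebra.

For completeness, the branching and scalar laws make a photon that enters a bipartite diagram act on
the effects as a derivation: it turns one annihilation at a time into a discard, with the weight of
the wire as a factor. So every closed diagram can be rewritten to a scalar, and by soundness this
scalar is its amplitude.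
-/

noncomputable section

namespace QPath

open Diag MvPolynomial

variable {k l m n l' m' n' : ℕ}

/-! ### Fock space -/

lemma Fock.map_ext {f g : Fock m →ₗ[ℂ] Fock n} (h : ∀ s, f (ket s) = g (ket s)) : f = g :=
  Finsupp.lhom_ext' fun s => LinearMap.ext_ring (h s)

lemma Fock.bilin_ext {f g : Fock m →ₗ[ℂ] Fock n →ₗ[ℂ] Fock k}
    (h : ∀ s t, f (ket s) (ket t) = g (ket s) (ket t)) : f = g :=
  Finsupp.lhom_ext' fun s => LinearMap.ext_ring <| Fock.map_ext (h s)

lemma exists_eq_append (s : Fin (m + n) → ℕ) :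
    ∃ (a : Fin m → ℕ) (b : Fin n → ℕ), s = Fin.append a b :=
  ⟨_, _, Fin.append_castAdd_natAdd.symm⟩

lemma Fock.map_ext_append {f g : Fock (m + m') →ₗ[ℂ] Fock n}
    (h : ∀ a b, f (ket (Fin.append a b)) = g (ket (Fin.append a b))) : f = g := by
  refine Fock.map_ext fun s => ?_
  obtain ⟨a, b, rfl⟩ := exists_eq_append s
  exact h a b

lemma Fock.map_ext_append_append {f g : Fock (k + m + m') →ₗ[ℂ] Fock n}
    (h : ∀ a b c, f (ket (Fin.append (Fin.append a b) c))
      = g (ket (Fin.append (Fin.append a b) c))) : f = g := by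
  refine Fock.map_ext_append fun s c => ?_
  obtain ⟨a, b, rfl⟩ := exists_eq_append s
  exact h a b c

@[simp] lemma ofKets_ket (v : (Fin m → ℕ) → Fock n) (s : Fin m → ℕ) :
    ofKets v (ket s) = v s := by
  simp [ofKets, ket]

/-- The tensor product of Fock space vectors, as a bilinear map. -/
def tensor (m n : ℕ) : Fock m →ₗ[ℂ] Fock n →ₗ[ℂ] Fock (m + n) :=
  Finsupp.linearCombination ℂ fun s =>
    Finsupp.linearCombination ℂ fun t => ket (Fin.append s t)

lemma tensorVec_eq_tensor (x : Fock m) (y : Fock n) : tensorVec x y = tensor m n x y := by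
  simp only [tensorVec, tensor, Finsupp.linearCombination_apply, Finsupp.sum,
    LinearMap.sum_apply, LinearMap.smul_apply, Finset.smul_sum, ket,
    Finsupp.smul_single, smul_eq_mul, mul_one]

@[simp] lemma tensor_ket_ket (s : Fin m → ℕ) (t : Fin n → ℕ) :
    tensor m n (ket s) (ket t) = ket (Fin.append s t) := by
  simp [tensor, ket]

@[simp] lemma tensorMap_ket_append (f : Fock m →ₗ[ℂ] Fock n) (g : Fock m' →ₗ[ℂ] Fock n')
    (a : Fin m → ℕ) (b : Fin m' → ℕ) :
    tensorMap f g (ket (Fin.append a b)) = tensor n n' (f (ket a)) (g (ket b)) := by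
  simp [tensorMap, tensorVec_eq_tensor]

@[simp] lemma tensorMap_tensor (f : Fock m →ₗ[ℂ] Fock n) (g : Fock m' →ₗ[ℂ] Fock n')
    (x : Fock m) (y : Fock m') :
    tensorMap f g (tensor m m' x y) = tensor n n' (f x) (g y) := by
  have : (tensor m m').compr₂ (tensorMap f g) = (tensor n n').compl₁₂ f g :=
    Fock.bilin_ext fun a b => by simp
  exact congr($this x y)

/-- Transport of Fock space along an equality of numbers of modes, the interpretation of
`Diag.cast`. -/
def reindex (h : m = n) : Fock m →ₗ[ℂ] Fock n :=
  ofKets fun s => ket fun i => s (Fin.cast h.symm i)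

lemma reindex_ket (h : m = n) (s : Fin m → ℕ) :
    reindex h (ket s) = ket fun i => s (Fin.cast h.symm i) := by
  simp [reindex]

@[simp] lemma reindex_rfl (h : m = m) : reindex h = LinearMap.id :=
  Fock.map_ext fun s => by simp [reindex_ket]

@[simp] lemma reindex_reindex (h : m = n) (h' : n = k) (x : Fock m) :
    reindex h' (reindex h x) = reindex (h.trans h') x := by
  subst h h'
  simp

lemma bosonic_cast (hm : m = m') (hn : n = n') (d : Diag m n) :
    bosonic (d.cast hm hn) = reindex hn ∘ₗ bosonic d ∘ₗ reindex hm.symm := by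
  subst hm hn
  simp [Diag.cast]

lemma bosonic_cast_eq_iff {hm : m = m'} {hn : n = n'} {d : Diag m n}
    {f : Fock m' →ₗ[ℂ] Fock n'} :
    bosonic (d.cast hm hn) = f ↔ reindex hn ∘ₗ bosonic d = f ∘ₗ reindex hm := by
  subst hm hn
  simp [Diag.cast]

@[simp] lemma reindex_ket_append_append (h : m + n + k = m + (n + k))
    (a : Fin m → ℕ) (b : Fin n → ℕ) (c : Fin k → ℕ) :
    reindex h (ket (Fin.append (Fin.append a b) c)) = ket (Fin.append a (Fin.append b c)) := by
  simp [reindex_ket, Fin.append_assoc, Function.comp_def]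

@[simp] lemma reindex_symm_ket_append_append (h : m + (n + k) = m + n + k)
    (a : Fin m → ℕ) (b : Fin n → ℕ) (c : Fin k → ℕ) :
    reindex h (ket (Fin.append a (Fin.append b c))) = ket (Fin.append (Fin.append a b) c) := by
  rw [← reindex_ket_append_append h.symm, reindex_reindex, reindex_rfl, LinearMap.id_apply]

lemma reindex_tensor_tensor (h : m + n + k = m + (n + k)) (x : Fock m) (y : Fock n)
    (z : Fock k) : reindex h (tensor _ _ (tensor _ _ x y) z) = tensor _ _ x (tensor _ _ y z) := by
  have on_kets (a b) : reindex h ∘ₗ tensor _ _ (ket (Fin.append a b))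
      = tensor m (n + k) (ket a) ∘ₗ tensor n k (ket b) := Fock.map_ext fun c => by simp
  have : (tensor m n).compr₂ (reindex h ∘ₗ (tensor (m + n) k).flip z)
      = (tensor m (n + k)).compl₂ ((tensor n k).flip z) :=
    Fock.bilin_ext fun a b => by simpa using congr($(on_kets a b) z)
  exact congr($this x y)

@[simp] lemma reindex_ket_append_left {h : 0 + n = n} (s : Fin 0 → ℕ) (t : Fin n → ℕ) :
    reindex h (ket (Fin.append s t)) = ket t := by
  rw [reindex_ket, Fin.append_left_nil s t rfl]
  rfl

@[simp] lemma reindex_tensor_ket_zero {h : 0 + n = n} (s : Fin 0 → ℕ) (x : Fock n) :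
    reindex h (tensor 0 n (ket s) x) = x := by
  have : reindex h ∘ₗ tensor 0 n (ket s) = LinearMap.id := Fock.map_ext fun t => by simp
  exact congr($this x)

@[simp] lemma ket_append_right (s : Fin n → ℕ) (t : Fin 0 → ℕ) :
    ket (Fin.append s t) = ket s := by
  rw [Fin.append_right_nil s t rfl]
  rfl

@[simp] lemma tensor_ket_zero (s : Fin 0 → ℕ) (x : Fock n) : tensor n 0 x (ket s) = x := by
  have : (tensor n 0).flip (ket s) = LinearMap.id :=
    Fock.map_ext fun t => (tensor_ket_ket t s).trans (ket_append_right t s)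
  exact congr($this x)

/-- The exchange of two groups of modes, the interpretation of `Diag.swap`. -/
def exchange (m n : ℕ) : Fock (m + n) →ₗ[ℂ] Fock (n + m) := bosonic (swap m n)

@[simp] lemma exchange_ket_append (a : Fin m → ℕ) (b : Fin n → ℕ) :
    exchange m n (ket (Fin.append a b)) = ket (Fin.append b a) := by
  simp [exchange, bosonic]

@[simp] lemma exchange_tensor (x : Fock m) (y : Fock n) :
    exchange m n (tensor m n x y) = tensor n m y x := by
  have : (tensor m n).compr₂ (exchange m n) = (tensor n m).flip :=
    Fock.bilin_ext fun a b => by simp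
  exact congr($this x y)

lemma bosonic_seq (f : Diag l m) (g : Diag m n) : bosonic (f.seq g) = bosonic g ∘ₗ bosonic f := rfl

lemma bosonic_par (f : Diag m n) (g : Diag m' n') :
    bosonic (f.par g) = tensorMap (bosonic f) (bosonic g) := rfl

lemma bosonic_swap (m n : ℕ) : bosonic (swap m n) = exchange m n := rfl

lemma tensorMap_id (m n : ℕ) :
    tensorMap (LinearMap.id : Fock m →ₗ[ℂ] Fock m) (LinearMap.id : Fock n →ₗ[ℂ] Fock n)
      = LinearMap.id :=
  Fock.map_ext_append fun a b => by simp

lemma tensorMap_comp (f : Fock l →ₗ[ℂ] Fock m) (g : Fock m →ₗ[ℂ] Fock n)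
    (f' : Fock l' →ₗ[ℂ] Fock m') (g' : Fock m' →ₗ[ℂ] Fock n') :
    tensorMap (g ∘ₗ f) (g' ∘ₗ f') = tensorMap g g' ∘ₗ tensorMap f f' :=
  Fock.map_ext_append fun a b => by simp

lemma reindex_comp_tensorMap_id_left (f : Fock m →ₗ[ℂ] Fock n) :
    reindex (Nat.zero_add n) ∘ₗ tensorMap (LinearMap.id : Fock 0 →ₗ[ℂ] Fock 0) f
      = f ∘ₗ reindex (Nat.zero_add m) :=
  Fock.map_ext_append fun a b => by simp

lemma tensorMap_id_right (f : Fock m →ₗ[ℂ] Fock n) :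
    tensorMap f (LinearMap.id : Fock 0 →ₗ[ℂ] Fock 0) = f :=
  Fock.map_ext_append fun a b =>
    (tensorMap_ket_append _ _ a b).trans <| (tensor_ket_zero _ _).trans <|
      congrArg f (ket_append_right a b).symm

lemma reindex_comp_tensorMap_tensorMap {m'' n'' : ℕ} (f : Fock m →ₗ[ℂ] Fock n)
    (g : Fock m' →ₗ[ℂ] Fock n') (h : Fock m'' →ₗ[ℂ] Fock n'') :
    reindex (Nat.add_assoc n n' n'') ∘ₗ tensorMap (tensorMap f g) h
      = tensorMap f (tensorMap g h) ∘ₗ reindex (Nat.add_assoc m m' m'') :=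
  Fock.map_ext_append_append fun a b c => by simp [reindex_tensor_tensor]

lemma exchange_comp_tensorMap (f : Fock m →ₗ[ℂ] Fock n) (g : Fock m' →ₗ[ℂ] Fock n') :
    exchange n n' ∘ₗ tensorMap f g = tensorMap g f ∘ₗ exchange m m' :=
  Fock.map_ext_append fun a b => by simp

lemma exchange_comp_exchange (m n : ℕ) : exchange n m ∘ₗ exchange m n = LinearMap.id :=
  Fock.map_ext_append fun a b => by simp

lemma reindex_comp_exchange_zero (m : ℕ) :
    reindex (Nat.zero_add m) ∘ₗ exchange m 0 = LinearMap.id :=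
  Fock.map_ext_append fun a b =>
    (congrArg (reindex (Nat.zero_add m)) (exchange_ket_append a b)).trans <|
      (reindex_ket_append_left b a).trans (ket_append_right a b).symm

lemma exchange_add_comp_reindex (m n k : ℕ) :
    exchange m (n + k) ∘ₗ reindex (Nat.add_assoc m n k)
      = reindex (Nat.add_assoc n k m).symm ∘ₗ tensorMap LinearMap.id (exchange m k)
        ∘ₗ reindex (Nat.add_assoc n m k) ∘ₗ tensorMap (exchange m n) LinearMap.id :=
  Fock.map_ext_append_append fun a b c => by simp

lemma bosonic_swap_add (m n k : ℕ) :
    bosonic (swap m (n + k)) =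
      bosonic (Diag.seq (m := n + (m + k))
        (Diag.cast (Nat.add_assoc m n k) (Nat.add_assoc n m k) ((swap m n).par (idn k)))
        (Diag.cast rfl (Nat.add_assoc n k m).symm ((idn n).par (swap m k)))) := by
  have cancel : reindex (Nat.add_assoc m n k) ∘ₗ reindex (Nat.add_assoc m n k).symm
      = LinearMap.id := LinearMap.ext fun x => by simp
  calc bosonic (swap m (n + k))
    _ = (exchange m (n + k) ∘ₗ reindex (Nat.add_assoc m n k))
          ∘ₗ reindex (Nat.add_assoc m n k).symm := by
        rw [LinearMap.comp_assoc, cancel, LinearMap.comp_id, bosonic_swap]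
    _ = _ := by
        rw [exchange_add_comp_reindex, bosonic_seq, bosonic_cast, bosonic_cast, reindex_rfl]
        rfl

/-! ### Second quantisation -/

/-- The norm `√(s₁! ⋯ sₘ!)` of the monomial with exponents `s` in the Bargmann representation. -/
def sqrtFactorial (s : Fin m → ℕ) : ℂ := ∏ i, (Real.sqrt (s i).factorial : ℂ)

lemma sqrt_factorial_ne_zero (n : ℕ) : (Real.sqrt n.factorial : ℂ) ≠ 0 := by
  simp [Nat.factorial_ne_zero]

lemma sqrtFactorial_ne_zero (s : Fin m → ℕ) : sqrtFactorial s ≠ 0 :=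
  Finset.prod_ne_zero_iff.mpr fun _ _ => sqrt_factorial_ne_zero _

lemma sqrtFactorial_append (s : Fin m → ℕ) (t : Fin n → ℕ) :
    sqrtFactorial (Fin.append s t) = sqrtFactorial s * sqrtFactorial t := by
  simp [sqrtFactorial, Fin.prod_univ_add]

lemma sqrtFactorial_ones (m : ℕ) : sqrtFactorial (fun _ : Fin m => 1) = 1 := by
  simp [sqrtFactorial]

lemma sqrtFactorial_comp_equiv (e : Fin n ≃ Fin m) (s : Fin m → ℕ) :
    sqrtFactorial (s ∘ e) = sqrtFactorial s :=
  e.prod_comp fun i => (Real.sqrt (s i).factorial : ℂ)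

lemma sqrt_mul_self_natCast (n : ℕ) : (Real.sqrt n : ℂ) * Real.sqrt n = n := by
  rw [← Complex.ofReal_mul, Real.mul_self_sqrt (by positivity), Complex.ofReal_natCast]

lemma sqrt_factorial_add (a b : ℕ) :
    (Real.sqrt (a + b).factorial : ℂ)
      = Real.sqrt ((a + b).choose a) * (Real.sqrt a.factorial * Real.sqrt b.factorial) := by
  rw [← Nat.add_choose_mul_factorial_mul_factorial a b, ← Nat.choose_symm_add, Nat.cast_mul,
    Nat.cast_mul, Real.sqrt_mul (by positivity), Real.sqrt_mul (by positivity)]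
  push_cast
  ring

/-- The Bargmann representation: a polynomial in the creation operators `X i`, applied to the
vacuum. It sends the monomial with exponents `s` to `√(s₁! ⋯ sₘ!) |s⟩`. -/
def bargmann (m : ℕ) : MvPolynomial (Fin m) ℂ →ₗ[ℂ] Fock m :=
  (basisMonomials (Fin m) ℂ).constr ℂ fun s => sqrtFactorial s • ket s

lemma bargmann_monomial (s : Fin m →₀ ℕ) (c : ℂ) :
    bargmann m (monomial s c) = (c * sqrtFactorial s) • ket s := by
  have : monomial s c = c • basisMonomials (Fin m) ℂ s := by simp [smul_monomial]
  rw [this, map_smul, bargmann, Module.Basis.constr_basis, smul_smul]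

lemma ket_eq_bargmann (s : Fin m → ℕ) :
    ket s = bargmann m (monomial (Finsupp.equivFunOnFinite.symm s) (sqrtFactorial s)⁻¹) := by
  simp [bargmann_monomial, sqrtFactorial_ne_zero]

lemma bargmann_prod_X_pow (s : Fin m → ℕ) :
    bargmann m (∏ i, X i ^ s i) = sqrtFactorial s • ket s := by
  have : (∏ i, X i ^ s i : MvPolynomial (Fin m) ℂ)
      = monomial (Finsupp.equivFunOnFinite.symm s) 1 := by
    rw [monomial_eq, Finsupp.prod_fintype _ _ fun _ => pow_zero _]
    simp
  simp [this, bargmann_monomial]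

lemma bargmann_one (s : Fin m → ℕ) (hs : ∀ i, s i = 0) : bargmann m 1 = ket s := by
  simpa [sqrtFactorial, hs] using bargmann_prod_X_pow s

lemma coe_mapDomain_castAdd_add_mapDomain_natAdd (s : Fin m →₀ ℕ) (t : Fin n →₀ ℕ) :
    ⇑(s.mapDomain (Fin.castAdd n) + t.mapDomain (Fin.natAdd m)) = Fin.append s t := by
  ext i
  cases i using Fin.addCases with
  | left i =>
    rw [Finsupp.add_apply, Finsupp.mapDomain_apply (Fin.castAdd_injective _ _),
      Finsupp.mapDomain_of_notMem_range, Fin.append_left, add_zero]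
    rintro ⟨j, hj⟩
    exact absurd (congrArg Fin.val hj) (by simp; omega)
  | right i =>
    rw [Finsupp.add_apply, Finsupp.mapDomain_apply (Fin.natAdd_injective _ _),
      Finsupp.mapDomain_of_notMem_range, Fin.append_right, zero_add]
    rintro ⟨j, hj⟩
    exact absurd (congrArg Fin.val hj) (by simp; omega)

lemma linearMap_ext_monomial {σ V : Type*} [AddCommMonoid V] [Module ℂ V]
    {f g : MvPolynomial σ ℂ →ₗ[ℂ] V} (h : ∀ s, f (monomial s 1) = g (monomial s 1)) : f = g :=
  (basisMonomials σ ℂ).ext fun s => by simpa using h s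

lemma bargmann_rename_mul_rename (p : MvPolynomial (Fin m) ℂ) (q : MvPolynomial (Fin n) ℂ) :
    bargmann (m + n) (rename (Fin.castAdd n) p * rename (Fin.natAdd m) q)
      = tensor m n (bargmann m p) (bargmann n q) := by
  have : ((LinearMap.mul ℂ _).compl₁₂ (rename (R := ℂ) (Fin.castAdd n)).toLinearMap
      (rename (R := ℂ) (Fin.natAdd m)).toLinearMap).compr₂ (bargmann (m + n))
      = (tensor m n).compl₁₂ (bargmann m) (bargmann n) := by
    refine linearMap_ext_monomial fun s => linearMap_ext_monomial fun t => ?_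
    simp only [LinearMap.compr₂_apply, LinearMap.compl₁₂_apply, AlgHom.toLinearMap_apply,
      LinearMap.mul_apply', rename_monomial, monomial_mul, bargmann_monomial, one_mul,
      coe_mapDomain_castAdd_add_mapDomain_natAdd, sqrtFactorial_append, map_smul,
      LinearMap.smul_apply, tensor_ket_ket, smul_smul]
    rw [mul_comm]
  exact congr($this p q)

lemma toMvPolynomial_eq_sum_smul_X (M : Matrix (Fin m) (Fin n) ℂ) (i : Fin m) :
    M.toMvPolynomial i = ∑ j, M i j • X j :=
  Finset.sum_congr rfl fun j _ => by rw [X, smul_monomial, smul_eq_mul, mul_one]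

/-- `f` is the second quantisation of the matrix `M`: in the Bargmann representation, it is the
substitution `X i ↦ ∑ j, M i j • X j`. -/
def IsSecondQuantization (f : Fock m →ₗ[ℂ] Fock n) (M : Matrix (Fin m) (Fin n) ℂ) : Prop :=
  ∀ p, f (bargmann m p) = bargmann n (bind₁ M.toMvPolynomial p)

namespace IsSecondQuantization

variable {f : Fock m →ₗ[ℂ] Fock n} {M : Matrix (Fin m) (Fin n) ℂ}

lemma of_ket (h : ∀ s : Fin m → ℕ,
    sqrtFactorial s • f (ket s) = bargmann n (∏ i, M.toMvPolynomial i ^ s i)) :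
    IsSecondQuantization f M := by
  have : f ∘ₗ bargmann m = bargmann n ∘ₗ (bind₁ M.toMvPolynomial).toLinearMap := by
    refine linearMap_ext_monomial fun s => ?_
    simp only [LinearMap.comp_apply, AlgHom.toLinearMap_apply, bind₁_monomial, map_one, one_mul,
      bargmann_monomial, map_smul, h s]
    rw [← Finsupp.prod, Finsupp.prod_fintype _ _ fun _ => pow_zero _]
  exact fun p => congr($this p)

lemma map_prod_X (hf : IsSecondQuantization f M) :
    f (bargmann m (∏ i, X i)) = bargmann n (∏ i, M.toMvPolynomial i) := by
  simp [hf _]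

lemma unique {g : Fock m →ₗ[ℂ] Fock n} (hf : IsSecondQuantization f M)
    (hg : IsSecondQuantization g M) : f = g :=
  Fock.map_ext fun s => by rw [ket_eq_bargmann, hf, hg]

lemma comp {g : Fock n →ₗ[ℂ] Fock k} {N : Matrix (Fin n) (Fin k) ℂ}
    (hf : IsSecondQuantization f M) (hg : IsSecondQuantization g N) :
    IsSecondQuantization (g ∘ₗ f) (M * N) := fun p => by
  have : (bind₁ (M * N).toMvPolynomial)
      = (bind₁ N.toMvPolynomial).comp (bind₁ M.toMvPolynomial) :=
    algHom_ext fun i => by simp [Matrix.toMvPolynomial_mul]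
  rw [LinearMap.comp_apply, hf, hg, this, AlgHom.comp_apply]

protected lemma id (m : ℕ) : IsSecondQuantization (LinearMap.id : Fock m →ₗ[ℂ] Fock m) 1 :=
  fun p => by simp

end IsSecondQuantization

/-- The direct sum of two matrices. -/
def directSum (M : Matrix (Fin m) (Fin n) ℂ) (N : Matrix (Fin m') (Fin n') ℂ) :
    Matrix (Fin (m + m')) (Fin (n + n')) ℂ :=
  (Matrix.fromBlocks M 0 0 N).submatrix finSumFinEquiv.symm finSumFinEquiv.symm

section directSum

variable (M : Matrix (Fin m) (Fin n) ℂ) (N : Matrix (Fin m') (Fin n') ℂ)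

@[simp] lemma directSum_castAdd_castAdd (i j) :
    directSum M N (Fin.castAdd _ i) (Fin.castAdd _ j) = M i j := by simp [directSum]

@[simp] lemma directSum_castAdd_natAdd (i j) :
    directSum M N (Fin.castAdd _ i) (Fin.natAdd _ j) = 0 := by simp [directSum]

@[simp] lemma directSum_natAdd_castAdd (i j) :
    directSum M N (Fin.natAdd _ i) (Fin.castAdd _ j) = 0 := by simp [directSum]

@[simp] lemma directSum_natAdd_natAdd (i j) :
    directSum M N (Fin.natAdd _ i) (Fin.natAdd _ j) = N i j := by simp [directSum]

lemma directSum_apply (i j) :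
    directSum M N i j =
      if hi : (i : ℕ) < m then if hj : (j : ℕ) < n then M ⟨i, hi⟩ ⟨j, hj⟩ else 0
      else if hj : (j : ℕ) < n then 0 else N ⟨i - m, by omega⟩ ⟨j - n, by omega⟩ := by
  cases i using Fin.addCases <;> cases j using Fin.addCases <;> simp

lemma bind₁_directSum_castAdd (p : MvPolynomial (Fin m) ℂ) :
    bind₁ (directSum M N).toMvPolynomial (rename (Fin.castAdd m') p)
      = rename (Fin.castAdd n') (bind₁ M.toMvPolynomial p) := by
  rw [bind₁_rename, rename_bind₁]
  congr 2
  ext1 i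
  simp [toMvPolynomial_eq_sum_smul_X, Fin.sum_univ_add]

lemma bind₁_directSum_natAdd (q : MvPolynomial (Fin m') ℂ) :
    bind₁ (directSum M N).toMvPolynomial (rename (Fin.natAdd m) q)
      = rename (Fin.natAdd n) (bind₁ N.toMvPolynomial q) := by
  rw [bind₁_rename, rename_bind₁]
  congr 2
  ext1 i
  simp [toMvPolynomial_eq_sum_smul_X, Fin.sum_univ_add]

end directSum

lemma IsSecondQuantization.tensorMap {f : Fock m →ₗ[ℂ] Fock n} {g : Fock m' →ₗ[ℂ] Fock n'}
    {M : Matrix (Fin m) (Fin n) ℂ} {N : Matrix (Fin m') (Fin n') ℂ}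
    (hf : IsSecondQuantization f M) (hg : IsSecondQuantization g N) :
    IsSecondQuantization (tensorMap f g) (directSum M N) := by
  refine .of_ket fun s => ?_
  obtain ⟨a, b, rfl⟩ := exists_eq_append s
  have split : (∏ i, (directSum M N).toMvPolynomial i ^ Fin.append a b i)
      = rename (Fin.castAdd n') (bind₁ M.toMvPolynomial (∏ i, X i ^ a i))
        * rename (Fin.natAdd n) (bind₁ N.toMvPolynomial (∏ i, X i ^ b i)) := by
    rw [← bind₁_directSum_castAdd M N, ← bind₁_directSum_natAdd M N]
    simp [Fin.prod_univ_add, -Fin.natAdd_eq_addNat]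
  rw [split, bargmann_rename_mul_rename, ← hf, ← hg, bargmann_prod_X_pow, bargmann_prod_X_pow,
    sqrtFactorial_append, tensorMap_ket_append]
  simp [smul_smul, mul_comm]

/-! ### The matrix of a Path diagram -/

/-- The matrix of a Path diagram: the entry `(i, j)` sums the weights of the paths from the input
`i` to the output `j`. Creations and annihilations have the junk value `0`. -/
def Diag.matrix : {m n : ℕ} → Diag m n → Matrix (Fin m) (Fin n) ℂ
  | _, _, idn _ => 1
  | _, _, seq f g => f.matrix * g.matrix
  | _, _, par f g => directSum f.matrix g.matrix
  | _, _, swap _ _ => (1 : Matrix _ _ ℂ).submatrix id finAddFlip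
  | _, _, copy => Matrix.of fun _ _ => 1
  | _, _, merge => Matrix.of fun _ _ => 1
  | _, _, discard => 0
  | _, _, unit => 0
  | _, _, endo r => Matrix.of fun _ _ => r
  | _, _, create _ => 0
  | _, _, annihilate _ => 0

/-- The diagrams of the Path calculus: those without creations and annihilations of photons. -/
def Diag.IsPath : {m n : ℕ} → Diag m n → Prop
  | _, _, seq f g => f.IsPath ∧ g.IsPath
  | _, _, par f g => f.IsPath ∧ g.IsPath
  | _, _, create _ => False
  | _, _, annihilate _ => False
  | _, _, _ => True

namespace IsSecondQuantization

lemma relabel {f : Fock m →ₗ[ℂ] Fock n} (e : Fin n ≃ Fin m)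
    (hf : ∀ s, f (ket s) = ket (s ∘ e)) :
    IsSecondQuantization f ((1 : Matrix _ _ ℂ).submatrix id e) := by
  refine .of_ket fun s => ?_
  have image_X (j) : ((1 : Matrix _ _ ℂ).submatrix id e).toMvPolynomial (e j) = X j := by
    simp [toMvPolynomial_eq_sum_smul_X, Matrix.one_apply]
  rw [hf, ← sqrtFactorial_comp_equiv e, ← bargmann_prod_X_pow, ← e.prod_comp]
  simp [image_X]

lemma swap (m n : ℕ) : IsSecondQuantization (bosonic (swap m n)) (swap m n).matrix := by
  refine relabel finAddFlip fun s => ?_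
  obtain ⟨a, b, rfl⟩ := exists_eq_append s
  rw [bosonic_swap, exchange_ket_append]
  congr 1
  ext i
  cases i using Fin.addCases <;> simp

lemma copy : IsSecondQuantization (bosonic copy) copy.matrix := by
  refine .of_ket fun s => ?_
  have term (k d : ℕ) :
      bargmann 2 (X 0 ^ k * X 1 ^ d * ((k + d).choose k : MvPolynomial (Fin 2) ℂ))
        = (Real.sqrt (k + d).factorial * Real.sqrt ((k + d).choose k) : ℂ) • ket ![k, d] := by
    have : (X 0 ^ k * X 1 ^ d * ((k + d).choose k : MvPolynomial (Fin 2) ℂ))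
        = ((k + d).choose k : ℂ) • ∏ i, X i ^ ![k, d] i := by
      simp [smul_eq_C_mul, mul_comm]
    rw [this, map_smul, bargmann_prod_X_pow, smul_smul, sqrt_factorial_add,
      ← sqrt_mul_self_natCast]
    simp only [sqrtFactorial, Fin.prod_univ_two, Matrix.cons_val_zero, Matrix.cons_val_one]
    congr 1
    ring
  simp only [bosonic, Diag.matrix, ofKets_ket, sqrtFactorial, Finset.univ_unique,
    Fin.default_eq_zero, Finset.prod_singleton, toMvPolynomial_eq_sum_smul_X, Matrix.of_apply,
    one_smul, Fin.sum_univ_two, add_pow, map_sum, Finset.smul_sum, smul_smul]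
  refine Finset.sum_congr rfl fun k hk => ?_
  obtain ⟨d, hd⟩ := Nat.exists_eq_add_of_le (Nat.lt_succ_iff.mp (Finset.mem_range.mp hk))
  rw [hd, add_tsub_cancel_left, term]

lemma merge : IsSecondQuantization (bosonic merge) merge.matrix := by
  refine .of_ket fun s => ?_
  have image : (∏ i, (Diag.matrix .merge).toMvPolynomial i ^ s i : MvPolynomial (Fin 1) ℂ)
      = ∏ i, X i ^ ![s 0 + s 1] i := by
    simp [Diag.matrix, toMvPolynomial_eq_sum_smul_X, Fin.prod_univ_two, pow_add]
  rw [image, bargmann_prod_X_pow]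
  simp only [bosonic, ofKets_ket, smul_smul, sqrtFactorial, Fin.prod_univ_two,
    Finset.univ_unique, Fin.default_eq_zero, Finset.prod_singleton, Matrix.cons_val_zero,
    sqrt_factorial_add]
  congr 1
  ring

lemma discard : IsSecondQuantization (bosonic .discard) (Diag.matrix .discard) := by
  refine .of_ket fun s => ?_
  by_cases hs : s 0 = 0
  · simp [bosonic, Diag.matrix, sqrtFactorial, hs, bargmann_one ![]]
  · simp [bosonic, Diag.matrix, hs]

lemma unit : IsSecondQuantization (bosonic unit) unit.matrix :=
  .of_ket fun s => by simp [bosonic, sqrtFactorial, bargmann_one ![0]]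

lemma endo (r : ℂ) : IsSecondQuantization (bosonic (endo r)) (endo r).matrix := by
  refine .of_ket fun s => ?_
  have := bargmann_prod_X_pow s
  simp only [Finset.univ_unique, Fin.default_eq_zero, Finset.prod_singleton] at this
  simp [bosonic, Diag.matrix, toMvPolynomial_eq_sum_smul_X, smul_pow, this, smul_smul, mul_comm]

end IsSecondQuantization

theorem isSecondQuantization_matrix :
    ∀ {m n : ℕ} (d : Diag m n), d.IsPath → IsSecondQuantization (bosonic d) d.matrix
  | _, _, idn n, _ => .id n
  | _, _, seq f g, h =>
    (isSecondQuantization_matrix f h.1).comp (isSecondQuantization_matrix g h.2)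
  | _, _, par f g, h =>
    (isSecondQuantization_matrix f h.1).tensorMap (isSecondQuantization_matrix g h.2)
  | _, _, swap m n, _ => .swap m n
  | _, _, copy, _ => .copy
  | _, _, merge, _ => .merge
  | _, _, .discard, _ => .discard
  | _, _, unit, _ => .unit
  | _, _, endo r, _ => .endo r

lemma bosonic_eq_of_matrix_eq {d e : Diag m n} (hd : d.IsPath) (he : e.IsPath)
    (h : d.matrix = e.matrix) : bosonic d = bosonic e :=
  (isSecondQuantization_matrix d hd).unique (h ▸ isSecondQuantization_matrix e he)

lemma finAddFlip_one_one : (finAddFlip : Fin (1 + 1) ≃ Fin (1 + 1)) = Equiv.swap 0 1 := by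
  ext i
  fin_cases i <;> rfl

theorem PathAxiom.sound {d e : Diag m n} (h : PathAxiom d e) : bosonic d = bosonic e := by
  cases h with
  | id_seq | seq_id | seq_assoc => rfl
  | par_id => exact tensorMap_id _ _
  | interchange => exact tensorMap_comp _ _ _ _
  | empty_par => exact bosonic_cast_eq_iff.mpr (reindex_comp_tensorMap_id_left _)
  | par_empty => exact tensorMap_id_right _
  | par_assoc => exact bosonic_cast_eq_iff.mpr (reindex_comp_tensorMap_tensorMap _ _ _)
  | swap_natural => exact exchange_comp_tensorMap _ _
  | swap_swap => exact exchange_comp_exchange _ _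
  | swap_zero =>
    rw [bosonic_cast_eq_iff, reindex_rfl]
    exact reindex_comp_exchange_zero _
  | swap_add => exact bosonic_swap_add _ _ _
  | _ =>
    refine bosonic_eq_of_matrix_eq (by simp [IsPath]) (by simp [IsPath]) ?_
    ext i j
    fin_cases i <;> fin_cases j <;>
      simp [Diag.matrix, finAddFlip_one_one, Matrix.mul_apply, directSum_apply,
        Fin.sum_univ_succ, Matrix.one_apply, -Finset.sum_boole]

lemma matrix_idn (n : ℕ) : (idn n).matrix = 1 := rfl

lemma matrix_seq (f : Diag l m) (g : Diag m n) : (f.seq g).matrix = f.matrix * g.matrix := rfl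

lemma matrix_par (f : Diag m n) (g : Diag m' n') :
    (f.par g).matrix = directSum f.matrix g.matrix := rfl

lemma matrix_cast (hm : m = m') (hn : n = n') (d : Diag m n) :
    (d.cast hm hn).matrix = d.matrix.submatrix (Fin.cast hm.symm) (Fin.cast hn.symm) := by
  subst hm hn
  rfl

lemma isPath_cast {hm : m = m'} {hn : n = n'} {d : Diag m n} :
    (d.cast hm hn).IsPath ↔ d.IsPath := by
  subst hm hn
  rfl

lemma isPath_copyN : ∀ n, (copyN n).IsPath
  | 0 => trivial
  | n + 1 => ⟨trivial, isPath_copyN n, trivial⟩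

lemma isPath_mergeN : ∀ n, (mergeN n).IsPath
  | 0 => trivial
  | n + 1 => ⟨⟨isPath_mergeN n, trivial⟩, trivial⟩

lemma isPath_units : ∀ n, (units n).IsPath
  | 0 => trivial
  | n + 1 => ⟨isPath_units n, trivial⟩

lemma isPath_parN : ∀ {n} {f : Fin n → Diag 1 1}, (∀ i, (f i).IsPath) → (parN n f).IsPath
  | 0, _, _ => trivial
  | _ + 1, _, hf => ⟨isPath_parN fun i => hf i.castSucc, hf _⟩

lemma isPath_mergeBundle : ∀ n, (mergeBundle n).IsPath
  | 0 => trivial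
  | n + 1 => ⟨isPath_cast.mpr ⟨⟨trivial, trivial⟩, trivial⟩, isPath_mergeBundle n, trivial⟩

lemma isPath_wires : ∀ {p q : ℕ} {f : Fin p → Fin q → Diag 1 1},
    (∀ i j, (f i j).IsPath) → (wires p q f).IsPath
  | 0, q, _, _ => isPath_units q
  | _ + 1, q, _, hf => ⟨⟨isPath_wires fun i j => hf i.castSucc j, isPath_copyN q,
      isPath_parN (hf _)⟩, isPath_mergeBundle q⟩

lemma matrix_copyN (n : ℕ) : (copyN n).matrix = Matrix.of fun _ _ => 1 := by
  induction n with
  | zero => exact Subsingleton.elim _ _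
  | succ n ih =>
    ext i j
    cases j using Fin.lastCases <;>
      simp [copyN, Diag.matrix, ih, Matrix.mul_apply, directSum_apply, Matrix.one_apply]

lemma matrix_mergeN (n : ℕ) : (mergeN n).matrix = Matrix.of fun _ _ => 1 := by
  induction n with
  | zero => exact Subsingleton.elim _ _
  | succ n ih =>
    ext i j
    cases i using Fin.lastCases <;>
      simp [mergeN, Diag.matrix, ih, Matrix.mul_apply, directSum_apply, Matrix.one_apply]

lemma matrix_parN : ∀ (n : ℕ) (f : Fin n → Diag 1 1),
    (parN n f).matrix = Matrix.diagonal fun i => (f i).matrix 0 0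
  | 0, _ => Subsingleton.elim _ _
  | n + 1, f => by
    ext i j
    cases i using Fin.lastCases <;> cases j using Fin.lastCases <;>
      simp [parN, Diag.matrix, matrix_parN n, directSum_apply, Matrix.diagonal_apply,
        Fin.castSucc_ne_last, (Fin.castSucc_ne_last _).symm]

lemma matrix_swap_apply (m n : ℕ) (i j) :
    (swap m n).matrix i j = if (i : ℕ) = if (j : ℕ) < n then j + m else j - n then 1 else 0 := by
  cases j using Fin.addCases <;>
    simp [Diag.matrix, Matrix.one_apply, Fin.ext_iff, add_comm]

lemma matrix_shuffle_apply (n : ℕ) (h : n + (1 + n) + 1 = n + 1 + (n + 1))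
    (h' : n + (n + 1) + 1 = n + n + (1 + 1)) (i k) :
    (Diag.cast h h' (((idn n).par (swap 1 n)).par (idn 1))).matrix i k =
      if k = ⟨if (i : ℕ) = n then n + n else if n < (i : ℕ) ∧ (i : ℕ) ≤ n + n then i - 1 else i,
        by split_ifs <;> omega⟩ then 1 else 0 := by
  simp only [matrix_cast, Matrix.submatrix_apply, matrix_par, directSum_apply,
    matrix_swap_apply, matrix_idn, Matrix.one_apply, Fin.ext_iff, Fin.val_cast]
  split_ifs <;> first | rfl | omega

lemma matrix_mergeBundle_apply (n : ℕ) (i j) :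
    (mergeBundle n).matrix i j = if (i : ℕ) = j ∨ (i : ℕ) = j + n then 1 else 0 := by
  induction n with
  | zero => exact j.elim0
  | succ n ih =>
    simp only [mergeBundle, matrix_seq, Matrix.mul_apply, matrix_shuffle_apply, ite_mul,
      one_mul, zero_mul, Finset.sum_ite_eq', Finset.mem_univ, if_true]
    simp only [Diag.matrix, directSum_apply, ih, Matrix.of_apply]
    split_ifs <;> first | rfl | omega

lemma mul_matrix_mergeBundle (M : Matrix (Fin m) (Fin (n + n)) ℂ) (i j) :
    (M * (mergeBundle n).matrix) i j = M i (Fin.castAdd n j) + M i (Fin.natAdd n j) := by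
  have left (k : Fin n) : ((k : ℕ) = j ∨ (k : ℕ) = j + n) ↔ k = j := by omega
  have right (k : Fin n) : (n + (k : ℕ) = j ∨ n + (k : ℕ) = j + n) ↔ k = j := by omega
  simp [Matrix.mul_apply, matrix_mergeBundle_apply, Fin.sum_univ_add, left, right,
    -Fin.natAdd_eq_addNat]

lemma matrix_wires : ∀ (p q : ℕ) (f : Fin p → Fin q → Diag 1 1),
    (wires p q f).matrix = Matrix.of fun i j => (f i j).matrix 0 0
  | 0, _, _ => Subsingleton.elim _ _
  | p + 1, q, f => by
    ext i j
    rw [wires, matrix_seq, mul_matrix_mergeBundle, matrix_par, matrix_wires p, matrix_seq,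
      matrix_copyN, matrix_parN]
    cases i using Fin.lastCases <;>
      simp [directSum_apply, Matrix.mul_apply, Matrix.diagonal_apply]

/-! ### Permanents and bipartite diagrams -/

/-- The sum of `∏ i, M i (σ i)` over the bijections `σ` from rows to columns: the permanent of a
matrix that need not be square. -/
def bijectionPermanent {p q : ℕ} (M : Matrix (Fin p) (Fin q) ℂ) : ℂ :=
  ∑ σ : Fin p → Fin q with Function.Bijective σ, ∏ i, M i (σ i)

lemma bijectionPermanent_eq_permanent {p q : ℕ} (M : Matrix (Fin p) (Fin q) ℂ)
    (e : Fin p ≃ Fin q) : bijectionPermanent M = (M.submatrix id e).permanent := by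
  rw [Matrix.permanent, bijectionPermanent]
  symm
  refine Finset.sum_bij (fun τ _ => e ∘ τ.symm) (fun τ _ => ?_) (fun τ _ τ' _ h => ?_)
    (fun σ hσ => ?_) fun τ _ => ?_
  · exact Finset.mem_filter.mpr ⟨Finset.mem_univ _, e.bijective.comp τ.symm.bijective⟩
  · have : τ.symm = τ'.symm := Equiv.ext fun i => e.injective (congrFun h i)
    simpa using congrArg Equiv.symm this
  · have hσ := (Finset.mem_filter.mp hσ).2
    exact ⟨((Equiv.ofBijective σ hσ).trans e.symm).symm, Finset.mem_univ _, by ext; simp⟩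
  · rw [← Equiv.prod_comp τ fun i => M i ((e ∘ τ.symm) i)]
    simp

lemma bijectionPermanent_eq_zero {p q : ℕ} (M : Matrix (Fin p) (Fin q) ℂ) (h : p ≠ q) :
    bijectionPermanent M = 0 := by
  refine Finset.sum_eq_zero fun σ hσ => absurd ?_ h
  simpa using Fintype.card_of_bijective (Finset.mem_filter.mp hσ).2

lemma bijectionPermanent_ones (p q : ℕ) :
    bijectionPermanent (Matrix.of fun (_ : Fin p) (_ : Fin q) => 1)
      = if p = q then (q.factorial : ℂ) else 0 := by
  split_ifs with h
  · subst h
    rw [bijectionPermanent_eq_permanent _ (Equiv.refl _)]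
    simp [Matrix.permanent, Fintype.card_perm]
  · exact bijectionPermanent_eq_zero _ h

lemma bijective_iff_card_fiber_eq_one {p q : ℕ} (σ : Fin p → Fin q) :
    Function.Bijective σ ↔ (fun j => (Finset.univ.filter fun i => σ i = j).card) = fun _ => 1 := by
  simp only [funext_iff, Finset.card_eq_one, Function.bijective_iff_existsUnique]
  refine forall_congr' fun j => ?_
  simp [ExistsUnique, Finset.eq_singleton_iff_unique_mem]

lemma prod_X_comp {p q : ℕ} (σ : Fin p → Fin q) :
    ∏ i, (X (σ i) : MvPolynomial (Fin q) ℂ)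
      = ∏ j, X j ^ (Finset.univ.filter fun i => σ i = j).card := by
  rw [← Finset.prod_fiberwise Finset.univ σ]
  refine Finset.prod_congr rfl fun j _ => ?_
  rw [Finset.prod_congr rfl fun i hi => by rw [(Finset.mem_filter.mp hi).2], Finset.prod_const]

lemma bargmann_prod_toMvPolynomial_apply_ones {p q : ℕ} (M : Matrix (Fin p) (Fin q) ℂ) :
    bargmann q (∏ i, M.toMvPolynomial i) (fun _ => 1) = bijectionPermanent M := by
  have term (σ : Fin p → Fin q) :
      bargmann q (∏ i, M i (σ i) • X (σ i)) (fun _ => 1)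
        = if Function.Bijective σ then ∏ i, M i (σ i) else 0 := by
    rw [Finset.prod_smul, prod_X_comp, map_smul, bargmann_prod_X_pow]
    simp only [bijective_iff_card_fiber_eq_one]
    split_ifs with h
    · simp [h, ket, sqrtFactorial_ones]
    · simp [ket, h]
  simp only [toMvPolynomial_eq_sum_smul_X, Finset.prod_univ_sum, Fintype.piFinset_univ, map_sum,
    Finsupp.finsetSum_apply, term, bijectionPermanent, Finset.sum_filter]

lemma bargmann_prod_X (m : ℕ) : bargmann m (∏ i, X i) = ket fun _ => 1 := by
  simpa [sqrtFactorial_ones] using bargmann_prod_X_pow fun _ : Fin m => 1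

lemma append_ones_singleton (n : ℕ) :
    Fin.append (fun _ : Fin n => 1) ![1] = fun _ => 1 := by
  ext i
  cases i using Fin.addCases <;> simp

lemma bosonic_creates_ket (n : ℕ) (s : Fin 0 → ℕ) :
    bosonic (creates n) (ket s) = ket fun _ => 1 := by
  induction n generalizing s with
  | zero => exact congrArg ket (Subsingleton.elim _ _)
  | succ n ih =>
    obtain ⟨a, b, rfl⟩ := exists_eq_append (m := 0) (n := 0) s
    refine (tensorMap_ket_append _ _ a b).trans ?_
    rw [ih, ← append_ones_singleton, ← tensor_ket_ket]
    simp [bosonic]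

lemma append_eq_ones_iff (a : Fin n → ℕ) (b : Fin 1 → ℕ) :
    (Fin.append a b = fun _ => 1) ↔ (a = fun _ => 1) ∧ b 0 = 1 := by
  simp [funext_iff, Fin.forall_fin_add]

lemma bosonic_annihilates_ket (n : ℕ) (s : Fin n → ℕ) :
    bosonic (annihilates n) (ket s) = if s = fun _ => 1 then ket ![] else 0 := by
  induction n with
  | zero =>
    rw [if_pos (Subsingleton.elim _ _)]
    exact congrArg ket (Subsingleton.elim _ _)
  | succ n ih =>
    obtain ⟨a, b, rfl⟩ := exists_eq_append (m := n) (n := 1) s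
    rw [annihilates, bosonic_par, tensorMap_ket_append, ih]
    simp only [append_eq_ones_iff, ite_and]
    split_ifs with ha hb
    · simp [bosonic, hb]
    · simp [bosonic, hb]
    · simp

lemma bosonic_annihilates (n : ℕ) (x : Fock n) :
    bosonic (annihilates n) x = x (fun _ => 1) • ket ![] := by
  have : bosonic (annihilates n)
      = (LinearMap.toSpanSingleton ℂ _ (ket ![])).comp (Finsupp.lapply fun _ => 1) :=
    Fock.map_ext fun s => by
      rw [bosonic_annihilates_ket]
      by_cases h : s = fun _ => 1 <;> simp [h, ket]
  exact congr($this x)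

lemma amplitude_bipartite {p q : ℕ} {d : Diag p q} (hd : d.IsPath) :
    amplitude ((creates p).seq (d.seq (annihilates q))) = bijectionPermanent d.matrix := by
  rw [amplitude, bosonic_seq, bosonic_seq, LinearMap.comp_apply, LinearMap.comp_apply,
    bosonic_creates_ket, ← bargmann_prod_X, (isSecondQuantization_matrix d hd).map_prod_X,
    bosonic_annihilates, bargmann_prod_toMvPolynomial_apply_ones]
  simp [ket]

lemma bosonic_creates_mergeN (n : ℕ) (s : Fin 0 → ℕ) :
    bosonic ((creates n).seq (mergeN n)) (ket s) = (Real.sqrt n.factorial : ℂ) • ket ![n] := by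
  have image : ∏ i, (mergeN n).matrix.toMvPolynomial i = ∏ i, X i ^ ![n] i := by
    simp [matrix_mergeN, toMvPolynomial_eq_sum_smul_X]
  rw [bosonic_seq, LinearMap.comp_apply, bosonic_creates_ket, ← bargmann_prod_X,
    (isSecondQuantization_matrix _ (isPath_mergeN n)).map_prod_X, image, bargmann_prod_X_pow]
  simp [sqrtFactorial]

lemma bosonic_copyN_annihilates (n k : ℕ) :
    bosonic ((copyN n).seq (annihilates n)) (ket ![k])
      = if k = n then (Real.sqrt n.factorial : ℂ) • ket ![] else 0 := by
  have sqrt_smul_ket : (Real.sqrt k.factorial : ℂ) • ket ![k] = bargmann 1 (∏ i, X i ^ ![k] i) := by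
    rw [bargmann_prod_X_pow]
    simp [sqrtFactorial]
  have image : bind₁ (copyN n).matrix.toMvPolynomial (∏ i, X i ^ ![k] i)
      = ∏ i : Fin k, (Matrix.of fun _ _ => 1 : Matrix _ (Fin n) ℂ).toMvPolynomial i := by
    simp [matrix_copyN, toMvPolynomial_eq_sum_smul_X]
  refine smul_right_injective _ (sqrt_factorial_ne_zero k) ?_
  simp only
  rw [← map_smul, sqrt_smul_ket, bosonic_seq, LinearMap.comp_apply,
    isSecondQuantization_matrix _ (isPath_copyN n), image, bosonic_annihilates,
    bargmann_prod_toMvPolynomial_apply_ones, bijectionPermanent_ones]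
  split_ifs with h
  · rw [h, smul_smul, sqrt_mul_self_natCast]
  · simp

/-! ### Formal sums and soundness -/

/-- Sequential composition of formal sums, as a bilinear map. -/
def Lin.seqBil (l m n : ℕ) : Lin l m →ₗ[ℂ] Lin m n →ₗ[ℂ] Lin l n :=
  Finsupp.linearCombination ℂ fun d =>
    Finsupp.linearCombination ℂ fun e => Lin.of (Diag.seq d e)

/-- Parallel composition of formal sums, as a bilinear map. -/
def Lin.parBil (m n m' n' : ℕ) : Lin m n →ₗ[ℂ] Lin m' n' →ₗ[ℂ] Lin (m + m') (n + n') :=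
  Finsupp.linearCombination ℂ fun d =>
    Finsupp.linearCombination ℂ fun e => Lin.of (Diag.par d e)

lemma Lin.seq_eq_seqBil (x : Lin l m) (y : Lin m n) : x.seq y = seqBil l m n x y := by
  simp only [Lin.seq, seqBil, Finsupp.linearCombination_apply, Finsupp.sum,
    LinearMap.sum_apply, LinearMap.smul_apply, Finset.smul_sum, Lin.of,
    Finsupp.smul_single, smul_eq_mul, mul_one]

lemma Lin.par_eq_parBil (x : Lin m n) (y : Lin m' n') : x.par y = parBil m n m' n' x y := by
  simp only [Lin.par, parBil, Finsupp.linearCombination_apply, Finsupp.sum,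
    LinearMap.sum_apply, LinearMap.smul_apply, Finset.smul_sum, Lin.of,
    Finsupp.smul_single, smul_eq_mul, mul_one]

@[simp] lemma Lin.seqBil_of (d : Diag l m) (e : Diag m n) :
    seqBil l m n (of d) (of e) = of (d.seq e) := by simp [seqBil, of]

@[simp] lemma Lin.parBil_of (d : Diag m n) (e : Diag m' n') :
    parBil m n m' n' (of d) (of e) = of (d.par e) := by simp [parBil, of]

@[simp] lemma bosonicLin_of (d : Diag m n) : bosonicLin (Lin.of d) = bosonic d := by
  simp [bosonicLin, Lin.of]

lemma Lin.map_ext {V : Type*} [AddCommMonoid V] [Module ℂ V] {f g : Lin m n →ₗ[ℂ] V}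
    (h : ∀ d, f (Lin.of d) = g (Lin.of d)) : f = g :=
  Finsupp.lhom_ext' fun d => LinearMap.ext_ring (h d)

lemma Lin.bilin_ext {V : Type*} [AddCommMonoid V] [Module ℂ V]
    {f g : Lin l m →ₗ[ℂ] Lin n k →ₗ[ℂ] V}
    (h : ∀ d e, f (Lin.of d) (Lin.of e) = g (Lin.of d) (Lin.of e)) : f = g :=
  Lin.map_ext fun d => Lin.map_ext fun e => h d e

lemma bosonicLin_seq (x : Lin l m) (y : Lin m n) :
    bosonicLin (x.seq y) = bosonicLin y ∘ₗ bosonicLin x := by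
  have : (Lin.seqBil l m n).compr₂ bosonicLin
      = ((LinearMap.llcomp ℂ (Fock l) (Fock m) (Fock n)).compl₁₂ bosonicLin bosonicLin).flip :=
    Lin.bilin_ext fun d e => LinearMap.ext fun v => by simp [bosonic_seq]
  rw [Lin.seq_eq_seqBil]
  exact congr($this x y)

/-- The tensor product of linear maps, as a bilinear map. -/
def tensorMapBil (m n m' n' : ℕ) :
    (Fock m →ₗ[ℂ] Fock n) →ₗ[ℂ] (Fock m' →ₗ[ℂ] Fock n') →ₗ[ℂ] Fock (m + m') →ₗ[ℂ] Fock (n + n') :=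
  LinearMap.mk₂ ℂ tensorMap
    (fun _ _ _ => Fock.map_ext_append fun _ _ => by simp)
    (fun _ _ _ => Fock.map_ext_append fun _ _ => by simp)
    (fun _ _ _ => Fock.map_ext_append fun _ _ => by simp)
    (fun _ _ _ => Fock.map_ext_append fun _ _ => by simp)

lemma bosonicLin_par (x : Lin m n) (y : Lin m' n') :
    bosonicLin (x.par y) = tensorMap (bosonicLin x) (bosonicLin y) := by
  have : (Lin.parBil m n m' n').compr₂ bosonicLin
      = (tensorMapBil m n m' n').compl₁₂ bosonicLin bosonicLin :=
    Lin.bilin_ext fun d e => by simp [tensorMapBil, bosonic_par]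
  rw [Lin.par_eq_parBil]
  exact congr($this x y)

theorem Rewrites.sound {ax : ∀ m n : ℕ, Lin m n → Lin m n → Prop}
    (sound_ax : ∀ {m n x y}, ax m n x y → bosonicLin x = bosonicLin y) {x y : Lin m n}
    (h : Rewrites ax x y) : bosonicLin x = bosonicLin y := by
  induction h with
  | rule h => exact sound_ax h
  | refl x => rfl
  | symm _ ih => exact ih.symm
  | trans _ _ ih ih' => exact ih.trans ih'
  | add _ _ ih ih' => rw [map_add, map_add, ih, ih']
  | smul c _ ih => rw [map_smul, map_smul, ih]
  | seq _ _ ih ih' => rw [bosonicLin_seq, bosonicLin_seq, ih, ih']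
  | par _ _ ih ih' => rw [bosonicLin_par, bosonicLin_par, ih, ih']

lemma exists_eq_singleton (s : Fin 1 → ℕ) : ∃ k, s = ![k] := ⟨s 0, by ext i; fin_cases i; rfl⟩

theorem NormAxiom.sound {x y : Lin m n} (h : NormAxiom x y) : bosonicLin x = bosonicLin y := by
  cases h with
  | path h => simp only [bosonicLin_of, h.sound]
  | create_norm n =>
    refine Fock.map_ext fun s => ?_
    rw [map_smul, bosonicLin_of, bosonicLin_of, LinearMap.smul_apply, bosonic_creates_mergeN,
      smul_smul, one_div_mul_cancel (sqrt_factorial_ne_zero n), one_smul]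
    exact ofKets_ket _ _
  | annihilate_norm n =>
    refine Fock.map_ext fun s => ?_
    obtain ⟨k, rfl⟩ := exists_eq_singleton s
    rw [map_smul, bosonicLin_of, bosonicLin_of, LinearMap.smul_apply, bosonic_copyN_annihilates,
      smul_ite, smul_smul, one_div_mul_cancel (sqrt_factorial_ne_zero n), one_smul, smul_zero]
    exact ofKets_ket _ _

lemma append_singleton_singleton (x y : ℕ) : Fin.append ![x] ![y] = ![x, y] := by
  ext i
  fin_cases i <;> rfl

lemma tensor_ket_singleton (x y : ℕ) : tensor 1 1 (ket ![x]) (ket ![y]) = ket ![x, y] := by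
  rw [tensor_ket_ket, append_singleton_singleton]

lemma bosonic_create_branch :
    bosonic ((create 1).seq copy)
      = bosonic ((create 1).par unit) + bosonic (unit.par (create 1)) := by
  refine Fock.map_ext fun s => ?_
  have copied : bosonic ((create 1).seq copy) (ket s) = ket ![1, 0] + ket ![0, 1] := by
    simp [bosonic, Finset.sum_range_succ, add_comm]
  have first : bosonic ((create 1).par unit) (ket s) = ket ![1, 0] := by
    obtain ⟨a, b, rfl⟩ := exists_eq_append (m := 0) (n := 0) s
    refine (tensorMap_ket_append _ _ a b).trans ?_
    simp [bosonic, tensor_ket_singleton]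
  have second : bosonic (unit.par (create 1)) (ket s) = ket ![0, 1] := by
    obtain ⟨a, b, rfl⟩ := exists_eq_append (m := 0) (n := 0) s
    refine (tensorMap_ket_append _ _ a b).trans ?_
    simp [bosonic, tensor_ket_singleton]
  rw [LinearMap.add_apply, copied, first, second]

lemma bosonic_annihilate_branch :
    bosonic (merge.seq (annihilate 1))
      = bosonic ((annihilate 1).par .discard) + bosonic (Diag.par .discard (annihilate 1)) := by
  refine Fock.map_ext_append (m := 1) (m' := 1) fun a b => ?_
  obtain ⟨x, rfl⟩ := exists_eq_singleton a
  obtain ⟨y, rfl⟩ := exists_eq_singleton b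
  rw [LinearMap.add_apply, bosonic_par, bosonic_par, tensorMap_ket_append, tensorMap_ket_append,
    append_singleton_singleton]
  rcases x with _ | _ | x <;> rcases y with _ | _ | y <;> simp [bosonic, Nat.add_eq_one_iff]

theorem QPathAxiom.sound {x y : Lin m n} (h : QPathAxiom x y) : bosonicLin x = bosonicLin y := by
  cases h with
  | norm h => exact h.sound
  | create_branch => simpa only [map_add, bosonicLin_of] using bosonic_create_branch
  | annihilate_branch => simpa only [map_add, bosonicLin_of] using bosonic_annihilate_branch
  | create_discard => exact Fock.map_ext fun s => by simp [bosonic]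
  | unit_annihilate => exact Fock.map_ext fun s => by simp [bosonic]
  | scalar r => exact Fock.map_ext fun s => by simp [bosonic, Subsingleton.elim s ![]]

/-! ### Perfect matchings -/

namespace WeightedBipartiteGraph

variable {p q : ℕ} (G : WeightedBipartiteGraph p q)

/-- The edge that joins two adjacent nodes of the two classes. -/
def edge {i : Fin p} {j : Fin q} (h : G.graph.Adj (Sum.inl i) (Sum.inr j)) : G.graph.edgeSet :=
  ⟨s(Sum.inl i, Sum.inr j), h⟩

variable {G} {i i' : Fin p} {j j' : Fin q} {σ τ : Fin p → Fin q}

@[simp] lemma inl_mem_edge {h : G.graph.Adj (Sum.inl i) (Sum.inr j)} :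
    Sum.inl i' ∈ (G.edge h : Sym2 (Fin p ⊕ Fin q)) ↔ i' = i := by simp [edge]

@[simp] lemma inr_mem_edge {h : G.graph.Adj (Sum.inl i) (Sum.inr j)} :
    Sum.inr j' ∈ (G.edge h : Sym2 (Fin p ⊕ Fin q)) ↔ j' = j := by simp [edge]

lemma edge_eq_edge_iff {h : G.graph.Adj (Sum.inl i) (Sum.inr j)}
    {h' : G.graph.Adj (Sum.inl i') (Sum.inr j')} : G.edge h = G.edge h' ↔ i = i' ∧ j = j' := by
  simp [edge, Subtype.ext_iff]

lemma exists_eq_edge (e : G.graph.edgeSet) :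
    ∃ (i : Fin p) (j : Fin q) (h : G.graph.Adj (Sum.inl i) (Sum.inr j)), e = G.edge h := by
  obtain ⟨⟨a, b⟩, h⟩ := e
  have h : G.graph.Adj a b := h
  rcases a with i | j <;> rcases b with i' | j'
  · exact absurd (G.bipartite h) (by simp)
  · exact ⟨i, j', h, rfl⟩
  · exact ⟨i', j, h.symm, Subtype.ext Sym2.eq_swap⟩
  · exact absurd (G.bipartite h) (by simp)

/-- The edges that join each node `i` of the first class to the node `σ i` of the second. -/
def edges (hσ : ∀ i, G.graph.Adj (Sum.inl i) (Sum.inr (σ i))) : Finset G.graph.edgeSet :=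
  Finset.univ.map ⟨fun i => G.edge (hσ i), fun _ _ h => (edge_eq_edge_iff.mp h).1⟩

lemma mem_edges {hσ : ∀ i, G.graph.Adj (Sum.inl i) (Sum.inr (σ i))} {e : G.graph.edgeSet} :
    e ∈ edges hσ ↔ ∃ i, G.edge (hσ i) = e := by
  simp only [edges, Finset.mem_map, Finset.mem_univ, true_and]
  rfl

lemma prod_weight_edges (hσ : ∀ i, G.graph.Adj (Sum.inl i) (Sum.inr (σ i))) :
    ∏ e ∈ edges hσ, G.weight e = ∏ i, G.adjacency i (σ i) := by
  simp [edges, adjacency, edge, hσ]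

lemma edges_injective {hσ : ∀ i, G.graph.Adj (Sum.inl i) (Sum.inr (σ i))}
    {hτ : ∀ i, G.graph.Adj (Sum.inl i) (Sum.inr (τ i))} (h : edges hσ = edges hτ) : σ = τ := by
  ext1 i
  have : G.edge (hσ i) ∈ edges hτ := h ▸ mem_edges.mpr ⟨i, rfl⟩
  obtain ⟨i', hi'⟩ := mem_edges.mp this
  obtain ⟨rfl, hσ_eq⟩ := edge_eq_edge_iff.mp hi'
  exact hσ_eq.symm

lemma isPerfectMatching_edges (hσ : ∀ i, G.graph.Adj (Sum.inl i) (Sum.inr (σ i)))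
    (bij : Function.Bijective σ) : G.IsPerfectMatching (edges hσ) := by
  simp only [IsPerfectMatching, mem_edges]
  rintro (i | j)
  · refine ⟨G.edge (hσ i), by simp, ?_⟩
    rintro _ ⟨⟨i', rfl⟩, hi⟩
    rw [inl_mem_edge.mp hi]
  · obtain ⟨i, rfl⟩ := bij.2 j
    refine ⟨G.edge (hσ i), by simp, ?_⟩
    rintro _ ⟨⟨i', rfl⟩, hj⟩
    rw [bij.1 (inr_mem_edge.mp hj)]

lemma IsPerfectMatching.exists_eq_edges {M : Finset G.graph.edgeSet} (hM : G.IsPerfectMatching M) :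
    ∃ (σ : Fin p → Fin q) (hσ : ∀ i, G.graph.Adj (Sum.inl i) (Sum.inr (σ i))),
      Function.Bijective σ ∧ edges hσ = M := by
  have partner (i) : ∃ j, ∃ h : G.graph.Adj (Sum.inl i) (Sum.inr j), G.edge h ∈ M := by
    obtain ⟨e, ⟨he, hi⟩, -⟩ := hM (Sum.inl i)
    obtain ⟨i', j, h, rfl⟩ := exists_eq_edge e
    obtain rfl := inl_mem_edge.mp hi
    exact ⟨j, h, he⟩
  choose σ hσ mem using partner
  have edges_eq : edges hσ = M := by
    ext e
    refine mem_edges.trans ⟨by rintro ⟨i, rfl⟩; exact mem i, fun he => ?_⟩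
    obtain ⟨i, j, h, rfl⟩ := exists_eq_edge e
    exact ⟨i, (hM (Sum.inl i)).unique ⟨mem i, by simp⟩ ⟨he, by simp⟩⟩
  refine ⟨σ, hσ, ⟨fun i i' hi => ?_, fun j => ?_⟩, edges_eq⟩
  · have := (hM (Sum.inr (σ i))).unique ⟨mem i, by simp⟩ ⟨mem i', by simp [hi]⟩
    exact (edge_eq_edge_iff.mp this).1
  · obtain ⟨e, ⟨he, hj⟩, -⟩ := hM (Sum.inr j)
    obtain ⟨i, rfl⟩ := mem_edges.mp (edges_eq ▸ he)
    exact ⟨i, (inr_mem_edge.mp hj).symm⟩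

variable (G)

lemma matchingSum_eq_bijectionPermanent : G.matchingSum = bijectionPermanent G.adjacency := by
  classical
  have adjacent : bijectionPermanent G.adjacency
      = ∑ σ : Fin p → Fin q with Function.Bijective σ ∧
          ∀ i, G.graph.Adj (Sum.inl i) (Sum.inr (σ i)), ∏ i, G.adjacency i (σ i) := by
    rw [bijectionPermanent, ← Finset.filter_filter]
    refine (Finset.sum_filter_of_ne fun σ _ h i => ?_).symm
    by_contra hi
    exact h (Finset.prod_eq_zero (Finset.mem_univ i) (by simp [adjacency, hi]))
  rw [adjacent, matchingSum]
  symm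
  refine Finset.sum_bij (fun σ hσ => edges (Finset.mem_filter.mp hσ).2.2) (fun σ hσ => ?_)
    (fun _ _ _ _ h => edges_injective h) (fun M hM => ?_) fun σ _ => (prod_weight_edges _).symm
  · simpa using isPerfectMatching_edges _ (Finset.mem_filter.mp hσ).2.1
  · obtain ⟨σ, hσ, bij, rfl⟩ := IsPerfectMatching.exists_eq_edges (Finset.mem_filter.mp hM).2
    exact ⟨σ, Finset.mem_filter.mpr ⟨Finset.mem_univ _, bij, hσ⟩, rfl⟩

lemma amplitude_diagram : amplitude G.diagram = bijectionPermanent G.adjacency := by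
  rw [diagram, amplitude_bipartite, matrix_wires]
  · congr 1
    ext i j
    by_cases h : G.graph.Adj (Sum.inl i) (Sum.inr j) <;> simp [adjacency, h, Diag.matrix]
  · refine isPath_wires fun i j => ?_
    split_ifs <;> simp [IsPath]

end WeightedBipartiteGraph

theorem IsNormalForm.amplitude_eq {d : Diag 0 0} {p q : ℕ} {G : WeightedBipartiteGraph p q}
    {N : ℂ} (h : IsNormalForm d G N) : amplitude d = N * bijectionPermanent G.adjacency := by
  have := h.sound NormAxiom.sound
  rw [map_smul, bosonicLin_of, bosonicLin_of] at this
  rw [← G.amplitude_diagram, amplitude, amplitude, this]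
  rfl

/-! ### Diagrams modulo rewriting -/

/-- A set of rewrite rules between formal sums of diagrams. -/
abbrev Rules : Type := ∀ m n : ℕ, Lin m n → Lin m n → Prop

lemma Rewrites.mono {ax ax' : Rules} {x y : Lin m n} (h : Rewrites ax x y)
    (le : ∀ {m n : ℕ} {x y : Lin m n}, ax m n x y → ax' m n x y) : Rewrites ax' x y := by
  induction h with
  | rule h => exact .rule (le h)
  | refl x => exact .refl x
  | symm _ ih => exact ih.symm
  | trans _ _ ih ih' => exact ih.trans ih'
  | add _ _ ih ih' => exact ih.add ih'
  | smul c _ ih => exact ih.smul c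
  | seq _ _ ih ih' => exact ih.seq ih'
  | par _ _ ih ih' => exact ih.par ih'

/-- A set of rules from which the axioms of Path can be derived. -/
class IncludesPath (ax : Rules) : Prop where
  rewrites {m n : ℕ} {d e : Diag m n} : PathAxiom d e → Rewrites ax (Lin.of d) (Lin.of e)

instance : IncludesPath @NormAxiom := ⟨fun h => .rule (.path h)⟩

instance : IncludesPath @QPathAxiom := ⟨fun h => .rule (.norm (.path h))⟩

/-- The formal sums of diagrams that can be rewritten to zero. -/
def nullSums (ax : Rules) (m n : ℕ) : Submodule ℂ (Lin m n) where
  carrier := {x | Rewrites ax x 0}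
  zero_mem' := .refl 0
  add_mem' hx hy := by simpa using hx.add hy
  smul_mem' c x hx := by simpa using hx.smul c

lemma rewrites_iff_sub_mem {ax : Rules} {x y : Lin m n} :
    Rewrites ax x y ↔ x - y ∈ nullSums ax m n := by
  constructor
  · intro hxy
    have hxy' : Rewrites ax (x + -y) (y + -y) := hxy.add (.refl _)
    rwa [add_neg_cancel, ← sub_eq_add_neg] at hxy'
  · intro hxy
    simpa using Rewrites.add hxy (.refl y)

/-- Formal sums of diagrams modulo rewriting. -/
abbrev Cls (ax : Rules) (m n : ℕ) : Type := Lin m n ⧸ nullSums ax m n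

namespace Cls

variable {ax : Rules}

/-- The class of a formal sum. -/
def ofLin (ax : Rules) : Lin m n →ₗ[ℂ] Cls ax m n := (nullSums ax m n).mkQ

/-- The class of a diagram. -/
def mk (ax : Rules) (d : Diag m n) : Cls ax m n := ofLin ax (Lin.of d)

lemma ofLin_eq_iff {x y : Lin m n} : ofLin ax x = ofLin ax y ↔ Rewrites ax x y :=
  (Submodule.Quotient.eq _).trans rewrites_iff_sub_mem.symm

lemma ofLin_surjective : Function.Surjective (ofLin ax : Lin m n → Cls ax m n) :=
  Submodule.mkQ_surjective _

/-- Sequential composition of classes. -/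
def seq : Cls ax l m → Cls ax m n → Cls ax l n :=
  Quotient.map₂ Lin.seq fun _ _ hx _ _ hy =>
    Quotient.exact <| ofLin_eq_iff.mpr <|
      .seq (ofLin_eq_iff.mp <| Quotient.sound hx) (ofLin_eq_iff.mp <| Quotient.sound hy)

/-- Parallel composition of classes. -/
def par : Cls ax m n → Cls ax m' n' → Cls ax (m + m') (n + n') :=
  Quotient.map₂ Lin.par fun _ _ hx _ _ hy =>
    Quotient.exact <| ofLin_eq_iff.mpr <|
      .par (ofLin_eq_iff.mp <| Quotient.sound hx) (ofLin_eq_iff.mp <| Quotient.sound hy)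

lemma ofLin_seq (x : Lin l m) (y : Lin m n) :
    (ofLin ax x).seq (ofLin ax y) = ofLin ax (Lin.seqBil l m n x y) :=
  congrArg (ofLin ax) (Lin.seq_eq_seqBil x y)

lemma ofLin_par (x : Lin m n) (y : Lin m' n') :
    (ofLin ax x).par (ofLin ax y) = ofLin ax (Lin.parBil m n m' n' x y) :=
  congrArg (ofLin ax) (Lin.par_eq_parBil x y)

/-- Transport along equalities of the numbers of wires. -/
def cast (hm : m = m') (hn : n = n') (x : Cls ax m n) : Cls ax m' n' := hm ▸ hn ▸ x

@[simp] lemma mk_seq (d : Diag l m) (e : Diag m n) :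
    mk ax (d.seq e) = (mk ax d).seq (mk ax e) := by
  simp only [mk, ofLin_seq, Lin.seqBil_of]

@[simp] lemma mk_par (d : Diag m n) (e : Diag m' n') :
    mk ax (d.par e) = (mk ax d).par (mk ax e) := by
  simp only [mk, ofLin_par, Lin.parBil_of]

@[simp] lemma mk_cast (hm : m = m') (hn : n = n') (d : Diag m n) :
    mk ax (d.cast hm hn) = (mk ax d).cast hm hn := by
  subst hm hn; rfl

lemma isLinearMap_seq_left (y : Cls ax m n) : IsLinearMap ℂ fun x : Cls ax l m => x.seq y := by
  obtain ⟨y, rfl⟩ := ofLin_surjective y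
  refine ⟨ofLin_surjective.forall₂.mpr fun x x' => ?_,
    fun c => ofLin_surjective.forall.mpr fun x => ?_⟩ <;>
  simp only [← map_add, ← LinearMap.map_smul, ofLin_seq, ← LinearMap.add_apply, LinearMap.map_smul₂]

lemma isLinearMap_seq_right (x : Cls ax l m) : IsLinearMap ℂ fun y : Cls ax m n => x.seq y := by
  obtain ⟨x, rfl⟩ := ofLin_surjective x
  refine ⟨ofLin_surjective.forall₂.mpr fun y y' => ?_,
    fun c => ofLin_surjective.forall.mpr fun y => ?_⟩ <;>
  simp only [← map_add, ← map_smul, ofLin_seq]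

lemma isLinearMap_par_left (y : Cls ax m' n') : IsLinearMap ℂ fun x : Cls ax m n => x.par y := by
  obtain ⟨y, rfl⟩ := ofLin_surjective y
  refine ⟨ofLin_surjective.forall₂.mpr fun x x' => ?_,
    fun c => ofLin_surjective.forall.mpr fun x => ?_⟩ <;>
  simp only [← map_add, ← LinearMap.map_smul, ofLin_par, ← LinearMap.add_apply, LinearMap.map_smul₂]

lemma isLinearMap_par_right (x : Cls ax m n) : IsLinearMap ℂ fun y : Cls ax m' n' => x.par y := by
  obtain ⟨x, rfl⟩ := ofLin_surjective x
  refine ⟨ofLin_surjective.forall₂.mpr fun y y' => ?_,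
    fun c => ofLin_surjective.forall.mpr fun y => ?_⟩ <;>
  simp only [← map_add, ← map_smul, ofLin_par]

@[simp] lemma add_seq (x x' : Cls ax l m) (y : Cls ax m n) :
    (x + x').seq y = x.seq y + x'.seq y := (isLinearMap_seq_left y).map_add x x'

@[simp] lemma seq_add (x : Cls ax l m) (y y' : Cls ax m n) :
    x.seq (y + y') = x.seq y + x.seq y' := (isLinearMap_seq_right x).map_add y y'

@[simp] lemma smul_seq (c : ℂ) (x : Cls ax l m) (y : Cls ax m n) :
    (c • x).seq y = c • x.seq y := (isLinearMap_seq_left y).map_smul c x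

@[simp] lemma seq_smul (c : ℂ) (x : Cls ax l m) (y : Cls ax m n) :
    x.seq (c • y) = c • x.seq y := (isLinearMap_seq_right x).map_smul c y

@[simp] lemma add_par (x x' : Cls ax m n) (y : Cls ax m' n') :
    (x + x').par y = x.par y + x'.par y := (isLinearMap_par_left y).map_add x x'

@[simp] lemma par_add (x : Cls ax m n) (y y' : Cls ax m' n') :
    x.par (y + y') = x.par y + x.par y' := (isLinearMap_par_right x).map_add y y'

@[simp] lemma smul_par (c : ℂ) (x : Cls ax m n) (y : Cls ax m' n') :
    (c • x).par y = c • x.par y := (isLinearMap_par_left y).map_smul c x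

@[simp] lemma par_smul (c : ℂ) (x : Cls ax m n) (y : Cls ax m' n') :
    x.par (c • y) = c • x.par y := (isLinearMap_par_right x).map_smul c y

@[simp] lemma cast_add (hm : m = m') (hn : n = n') (x y : Cls ax m n) :
    cast hm hn (x + y) = cast hm hn x + cast hm hn y := by
  subst hm hn; rfl

@[simp] lemma cast_smul (hm : m = m') (hn : n = n') (c : ℂ) (x : Cls ax m n) :
    cast hm hn (c • x) = c • cast hm hn x := by
  subst hm hn; rfl

lemma ext_of_linear {V : Type*} [AddCommGroup V] [Module ℂ V] {f g : Cls ax m n → V}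
    (x : Cls ax m n) (hfg : ∀ d, f (mk ax d) = g (mk ax d))
    (hf : IsLinearMap ℂ f := by constructor <;> simp)
    (hg : IsLinearMap ℂ g := by constructor <;> simp) : f x = g x := by
  have h : hf.mk' f = hg.mk' g :=
    Submodule.linearMap_qext _ (Finsupp.lhom_ext' fun d => LinearMap.ext_ring (hfg d))
  exact LinearMap.congr_fun h x

/-- The identity, as a morphism between equal numbers of wires. -/
def castId (ax : Rules) (h : m = n) : Cls ax m n := (mk ax (idn m)).cast rfl h

@[simp] lemma castId_rfl (m : ℕ) : castId ax (rfl : m = m) = mk ax (idn m) := rfl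

variable [IncludesPath ax]

lemma mk_eq {d e : Diag m n} (h : PathAxiom d e) : mk ax d = mk ax e :=
  ofLin_eq_iff.mpr (IncludesPath.rewrites h)

lemma id_seq (x : Cls ax m n) : (mk ax (idn m)).seq x = x := by
  apply ext_of_linear x (fun d => ?_)
  rw [← mk_seq, mk_eq (.id_seq d)]

lemma seq_id (x : Cls ax m n) : x.seq (mk ax (idn n)) = x := by
  apply ext_of_linear x (fun d => ?_)
  rw [← mk_seq, mk_eq (.seq_id d)]

lemma seq_assoc (x : Cls ax k l) (y : Cls ax l m) (z : Cls ax m n) :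
    (x.seq y).seq z = x.seq (y.seq z) := by
  apply ext_of_linear x (fun d => ?_)
  apply ext_of_linear y (fun e => ?_)
  apply ext_of_linear z (fun f => ?_)
  simp only [← mk_seq, mk_eq (.seq_assoc d e f)]

lemma par_id (m n : ℕ) : (mk ax (idn m)).par (mk ax (idn n)) = mk ax (idn (m + n)) := by
  rw [← mk_par, mk_eq (.par_id m n)]

lemma interchange (x : Cls ax l m) (y : Cls ax m n) (x' : Cls ax l' m') (y' : Cls ax m' n') :
    (x.seq y).par (x'.seq y') = (x.par x').seq (y.par y') := by
  apply ext_of_linear x (fun d => ?_)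
  apply ext_of_linear y (fun e => ?_)
  apply ext_of_linear x' (fun d' => ?_)
  apply ext_of_linear y' (fun e' => ?_)
  simp only [← mk_seq, ← mk_par, mk_eq (.interchange d e d' e')]

lemma empty_par (x : Cls ax m n) :
    ((mk ax (idn 0)).par x).cast (Nat.zero_add m) (Nat.zero_add n) = x := by
  apply ext_of_linear x (fun d => ?_)
  rw [← mk_par, ← mk_cast, mk_eq (.empty_par d)]

lemma par_empty (x : Cls ax m n) : x.par (mk ax (idn 0)) = x := by
  apply ext_of_linear x (fun d => ?_) (isLinearMap_par_left _)
  rw [← mk_par]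
  exact mk_eq (.par_empty d)

lemma par_assoc {m'' n'' : ℕ} (x : Cls ax m n) (y : Cls ax m' n') (z : Cls ax m'' n'') :
    ((x.par y).par z).cast (Nat.add_assoc m m' m'') (Nat.add_assoc n n' n'')
      = x.par (y.par z) := by
  apply ext_of_linear x (fun d => ?_)
  apply ext_of_linear y (fun e => ?_)
  apply ext_of_linear z (fun f => ?_)
  simp only [← mk_par, ← mk_cast, mk_eq (.par_assoc d e f)]

lemma swap_natural (x : Cls ax m n) (y : Cls ax m' n') :
    (x.par y).seq (mk ax (swap n n')) = (mk ax (swap m m')).seq (y.par x) := by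
  apply ext_of_linear x (fun d => ?_)
  apply ext_of_linear y (fun e => ?_)
  simp only [← mk_seq, ← mk_par, mk_eq (.swap_natural d e)]

lemma cast_eq (hm : m = m') (hn : n = n') (x : Cls ax m n) :
    x.cast hm hn = (castId ax hm.symm).seq (x.seq (castId ax hn)) := by
  subst hm hn
  rw [castId_rfl, castId_rfl, id_seq, seq_id]
  rfl

@[simp] lemma castId_castId (h : l = m) (h' : m = n) :
    (castId ax h).seq (castId ax h') = castId ax (h.trans h') := by
  subst h h'
  exact id_seq _

@[simp] lemma castId_par (h : m = n) (h' : m' = n') :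
    (castId ax h).par (castId ax h') = castId ax (congrArg₂ (· + ·) h h') := by
  subst h h'
  exact par_id _ _

lemma cast_eq_iff (hm : m = m') (hn : n = n') (x : Cls ax m n) (y : Cls ax m' n') :
    x.cast hm hn = y ↔ x.seq (castId ax hn) = (castId ax hm).seq y := by
  subst hm hn
  rw [castId_rfl, castId_rfl, id_seq, seq_id]
  rfl

end Cls

/-! ### Commutative monoids and comonoids -/

open CategoryTheory MonoidalCategory MonObj ComonObj

section BraidedCategory

variable {C : Type*} [Category C] [MonoidalCategory C] [BraidedCategory C] {X : C}

/-- A monoid whose right unit law is derived from the left one by commutativity. -/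
abbrev monObjOfComm (one : 𝟙_ C ⟶ X) (mul : X ⊗ X ⟶ X) (one_mul : one ▷ X ≫ mul = (λ_ X).hom)
    (mul_comm : (β_ X X).hom ≫ mul = mul)
    (mul_assoc : mul ▷ X ≫ mul = (α_ X X X).hom ≫ X ◁ mul ≫ mul) : MonObj X where
  one := one
  mul := mul
  one_mul := one_mul
  mul_one := by
    rw [← mul_comm, BraidedCategory.braiding_naturality_right_assoc, one_mul, braiding_leftUnitor]
  mul_assoc := mul_assoc

/-- A comonoid whose right counit law is derived from the left one by cocommutativity. -/
abbrev comonObjOfComm (counit : X ⟶ 𝟙_ C) (comul : X ⟶ X ⊗ X)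
    (counit_comul : comul ≫ counit ▷ X = (λ_ X).inv) (comul_comm : comul ≫ (β_ X X).hom = comul)
    (comul_assoc : comul ≫ X ◁ comul = comul ≫ comul ▷ X ≫ (α_ X X X).hom) : ComonObj X where
  counit := counit
  comul := comul
  counit_comul := counit_comul
  comul_counit := by
    rw [← comul_comm, Category.assoc, ← BraidedCategory.braiding_naturality_left,
      reassoc_of% counit_comul, leftUnitor_inv_braiding]
  comul_assoc := comul_assoc

lemma comul_comul_tensorμ [ComonObj X] [IsCommComonObj X] :
    Δ[X] ≫ (Δ[X] ⊗ₘ Δ[X]) ≫ tensorμ X X X X = Δ[X] ≫ (Δ[X] ⊗ₘ Δ[X]) := by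
  have comul_assoc_right : Δ[X] ≫ (Δ[X] ⊗ₘ Δ[X]) ≫ (α_ X X (X ⊗ X)).hom
      = Δ[X] ≫ X ◁ (Δ[X] ≫ X ◁ Δ[X]) := by
    rw [MonoidalCategory.tensorHom_def, Category.assoc, associator_naturality_right,
      ← ComonObj.comul_assoc_assoc, MonoidalCategory.whiskerLeft_comp]
  have comul_assoc_left : Δ[X] ≫ X ◁ Δ[X] ≫ (α_ X X X).inv = Δ[X] ≫ Δ[X] ▷ X := by
    rw [ComonObj.comul_assoc_assoc, Iso.hom_inv_id, Category.comp_id]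
  rw [tensorμ, reassoc_of% comul_assoc_right]
  simp only [← MonoidalCategory.whiskerLeft_comp_assoc, Category.assoc]
  rw [reassoc_of% comul_assoc_left, ← comp_whiskerRight_assoc, IsCommComonObj.comul_comm,
    ← ComonObj.comul_assoc, ← reassoc_of% comul_assoc_right, Iso.hom_inv_id, Category.comp_id]

lemma rightUnitor_inv_tensorμ (X Y : C) :
    ((ρ_ X).inv ⊗ₘ (ρ_ Y).inv) ≫ tensorμ X (𝟙_ C) Y (𝟙_ C)
      = (ρ_ (X ⊗ Y)).inv ≫ (X ⊗ Y) ◁ (λ_ (𝟙_ C)).inv := by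
  simp only [tensorμ, braiding_tensorUnit_left]
  monoidal

lemma rightUnitor_leftUnitor_inv_tensorμ (X Y : C) :
    ((ρ_ X).inv ⊗ₘ (λ_ Y).inv) ≫ tensorμ X (𝟙_ C) (𝟙_ C) Y = (ρ_ X).inv ⊗ₘ (λ_ Y).inv := by
  simp only [tensorμ, braiding_tensorUnit_left]
  monoidal

end BraidedCategory

/-! ### The symmetric monoidal category of diagrams -/

/-- Numbers of wires, the objects of the category of diagrams modulo rewriting. -/
structure Wires (ax : Rules) where
  num : ℕ

variable {ax : Rules} [IncludesPath ax]

namespace Wires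

open Cls

instance : Category (Wires ax) where
  Hom X Y := Cls ax X.num Y.num
  id X := Cls.mk ax (idn X.num)
  comp f g := f.seq g
  id_comp f := id_seq f
  comp_id f := seq_id f
  assoc f g h := seq_assoc f g h

/-- The isomorphism between equal numbers of wires. -/
def castIso (X Y : Wires ax) (h : X.num = Y.num) : X ≅ Y where
  hom := castId ax h
  inv := castId ax h.symm
  hom_inv_id := castId_castId h h.symm
  inv_hom_id := castId_castId h.symm h

instance : MonoidalCategoryStruct (Wires ax) where
  tensorObj X Y := ⟨X.num + Y.num⟩
  whiskerLeft X _ _ f := (Cls.mk ax (idn X.num)).par f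
  whiskerRight f Y := f.par (Cls.mk ax (idn Y.num))
  tensorHom f g := f.par g
  tensorUnit := ⟨0⟩
  associator X Y Z := castIso _ _ (Nat.add_assoc X.num Y.num Z.num)
  leftUnitor X := castIso _ _ (Nat.zero_add X.num)
  rightUnitor X := castIso _ _ (Nat.add_zero X.num)

instance : MonoidalCategory (Wires ax) := .ofTensorHom
  (id_tensorHom_id := fun X Y => par_id X.num Y.num)
  (id_tensorHom := fun _ _ _ _ => rfl)
  (tensorHom_id := fun _ _ => rfl)
  (tensorHom_comp_tensorHom := fun f f' g g' => (interchange f g f' g').symm)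
  (associator_naturality := fun f g h => (cast_eq_iff _ _ _ _).mp (par_assoc f g h))
  (leftUnitor_naturality := fun f => (cast_eq_iff _ _ _ _).mp (empty_par f))
  (rightUnitor_naturality := fun f =>
    (cast_eq_iff (Nat.add_zero _) (Nat.add_zero _) _ _).mp (par_empty f))
  (pentagon := fun W X Y Z => by
    refine (congrArg₂ (fun a b => Cls.seq a (Cls.seq (castId ax _) b)) (castId_par _ rfl)
      (castId_par rfl _)).trans ?_
    simp only [castId_castId]
    exact (castId_castId _ _).symm)
  (triangle := fun X Y => by
    refine (congrArg (Cls.seq (castId ax (Nat.add_assoc X.num 0 Y.num)))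
      (castId_par rfl (Nat.zero_add Y.num))).trans ?_
    exact (castId_castId _ _).trans (castId_par (Nat.add_zero X.num) rfl).symm)

instance : Preadditive (Wires ax) where
  homGroup X Y := inferInstanceAs (AddCommGroup (Cls ax X.num Y.num))
  add_comp _ _ _ f f' g := add_seq f f' g
  comp_add _ _ _ f g g' := seq_add f g g'

instance : Linear ℂ (Wires ax) where
  homModule X Y := inferInstanceAs (Module ℂ (Cls ax X.num Y.num))
  smul_comp _ _ _ c f g := smul_seq c f g
  comp_smul _ _ _ f c g := seq_smul c f g

instance : MonoidalPreadditive (Wires ax) where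
  whiskerLeft_zero := (isLinearMap_par_right _).map_zero
  zero_whiskerRight := (isLinearMap_par_left _).map_zero
  whiskerLeft_add f g := par_add _ f g
  add_whiskerRight f g := add_par f g _

instance : MonoidalLinear ℂ (Wires ax) where
  whiskerLeft_smul _ _ _ c f := par_smul c _ f
  smul_whiskerRight c _ _ f _ := smul_par c f _

@[simp] lemma num_tensor (X Y : Wires ax) : (X ⊗ Y).num = X.num + Y.num := rfl

lemma associator_hom_eq_castIso (X Y Z : Wires ax) :
    (α_ X Y Z).hom = (castIso ((X ⊗ Y) ⊗ Z) (X ⊗ Y ⊗ Z) (Nat.add_assoc _ _ _)).hom := rfl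

lemma associator_inv_eq_castIso (X Y Z : Wires ax) :
    (α_ X Y Z).inv
      = (castIso (X ⊗ Y ⊗ Z) ((X ⊗ Y) ⊗ Z) (Nat.add_assoc _ _ _).symm).hom := rfl

lemma castIso_hom_castIso_hom (X Y Z : Wires ax) (h : X.num = Y.num) (h' : Y.num = Z.num) :
    (castIso X Y h).hom ≫ (castIso Y Z h').hom = (castIso X Z (h.trans h')).hom :=
  castId_castId h h'

lemma whiskerLeft_castIso (X Y Z : Wires ax) (h : Y.num = Z.num) :
    X ◁ (castIso Y Z h).hom
      = (castIso (X ⊗ Y) (X ⊗ Z) (congrArg (X.num + ·) h)).hom :=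
  castId_par rfl h

/-- The braiding. -/
def braid (X Y : Wires ax) : X ⊗ Y ≅ Y ⊗ X where
  hom := Cls.mk ax (swap X.num Y.num)
  inv := Cls.mk ax (swap Y.num X.num)
  hom_inv_id := (mk_seq _ _).symm.trans (mk_eq (.swap_swap _ _))
  inv_hom_id := (mk_seq _ _).symm.trans (mk_eq (.swap_swap _ _))

lemma braid_tensor_right (X Y Z : Wires ax) :
    (braid X (Y ⊗ Z)).hom = (α_ X Y Z).inv ≫ ((braid X Y).hom ▷ Z ≫ (α_ Y X Z).hom) ≫
      𝟙 _ ≫ Y ◁ (braid X Z).hom ≫ (α_ Y Z X).inv := by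
  have h := mk_eq (ax := ax) (.swap_add X.num Y.num Z.num)
  rw [mk_seq, mk_cast, mk_cast, Cls.cast_eq, Cls.cast_eq, mk_par, mk_par] at h
  exact h.trans (seq_assoc _ _ _)

lemma braid_hexagon (X Y Z : Wires ax) :
    (α_ X Y Z).hom ≫ (braid X (Y ⊗ Z)).hom ≫ (α_ Y Z X).hom =
      (braid X Y).hom ▷ Z ≫ (α_ Y X Z).hom ≫ Y ◁ (braid X Z).hom := by
  rw [braid_tensor_right]
  simp

instance : SymmetricCategory (Wires ax) where
  braiding := braid
  braiding_naturality_right _ _ _ f := swap_natural _ f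
  braiding_naturality_left f _ := swap_natural f _
  hexagon_forward := braid_hexagon
  hexagon_reverse X Y Z := by
    have hexagon : α_ Z X Y ≪≫ braid Z (X ⊗ Y) ≪≫ α_ X Y Z
        = whiskerRightIso (braid Z X) Y ≪≫ α_ X Z Y ≪≫ whiskerLeftIso X (braid Z Y) :=
      Iso.ext (braid_hexagon Z X Y)
    have hexagon_inv := congrArg Iso.inv hexagon
    simp only [Iso.trans_inv, Category.assoc, whiskerRightIso_inv, whiskerLeftIso_inv]
      at hexagon_inv
    exact hexagon_inv
  symmetry X Y := (braid X Y).hom_inv_id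

lemma tensorμ_eq_castIso (A B C D : Wires ax) :
    tensorμ A B C D
      = (castIso ((A ⊗ B) ⊗ C ⊗ D) ((A ⊗ B ⊗ C) ⊗ D)
          (by simp only [num_tensor, Nat.add_assoc])).hom ≫
        (A ◁ (β_ B C).hom) ▷ D ≫
        (castIso ((A ⊗ C ⊗ B) ⊗ D) ((A ⊗ C) ⊗ B ⊗ D)
          (by simp only [num_tensor, Nat.add_assoc])).hom := by
  rw [tensorμ, whisker_assoc]
  simp only [associator_hom_eq_castIso, associator_inv_eq_castIso, whiskerLeft_castIso,
    Category.assoc, castIso_hom_castIso_hom,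
    reassoc_of% (castIso_hom_castIso_hom (ax := ax))]

end Wires

/-! ### The bialgebra on one wire -/

/-- The bundle of `n` wires. -/
abbrev bundle (ax : Rules) (n : ℕ) : Wires ax := ⟨n⟩

/-- A single wire. -/
abbrev wire (ax : Rules) : Wires ax := ⟨1⟩

/-- The morphism of a diagram. -/
def arrow (ax : Rules) [IncludesPath ax] (d : Diag m n) : bundle ax m ⟶ bundle ax n :=
  Cls.mk ax d

lemma arrow_eq {d e : Diag m n} (h : PathAxiom d e) : arrow ax d = arrow ax e := Cls.mk_eq h

lemma arrow_seq (d : Diag l m) (e : Diag m n) :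
    arrow ax (d.seq e) = arrow ax d ≫ arrow ax e := Cls.mk_seq d e

lemma arrow_par (d : Diag m n) (e : Diag m' n') :
    arrow ax (d.par e) = arrow ax d ⊗ₘ arrow ax e := Cls.mk_par d e

instance : MonObj (wire ax) :=
  monObjOfComm (arrow ax unit) (arrow ax merge)
    (by
      have h := arrow_eq (ax := ax) .merge_unit
      rw [arrow_seq, arrow_par] at h
      exact h)
    (by
      have h := arrow_eq (ax := ax) .merge_comm
      rw [arrow_seq] at h
      exact h)
    (by
      have h := arrow_eq (ax := ax) .merge_assoc
      rw [arrow_seq, arrow_seq, arrow_par, arrow_par] at h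
      exact h.trans (Category.id_comp _).symm)

instance : ComonObj (wire ax) :=
  comonObjOfComm (arrow ax Diag.discard) (arrow ax copy)
    (by
      have h := arrow_eq (ax := ax) .copy_discard
      rw [arrow_seq, arrow_par] at h
      exact h)
    (by
      have h := arrow_eq (ax := ax) .copy_comm
      rw [arrow_seq] at h
      exact h)
    (by
      have h := arrow_eq (ax := ax) .copy_assoc
      rw [arrow_seq, arrow_seq, arrow_par, arrow_par] at h
      exact h.symm.trans (congrArg (arrow ax copy ≫ ·) (Category.comp_id _).symm))

instance : IsCommMonObj (wire ax) := ⟨(arrow_seq _ _).symm.trans (arrow_eq .merge_comm)⟩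

instance : IsCommComonObj (wire ax) := ⟨(arrow_seq _ _).symm.trans (arrow_eq .copy_comm)⟩

lemma arrow_shuffle (n : ℕ) (h : n + (1 + n) + 1 = n + 1 + (n + 1))
    (h' : n + (n + 1) + 1 = n + n + (1 + 1)) :
    arrow ax (Diag.cast h h' (((idn n).par (swap 1 n)).par (idn 1)))
      = tensorμ (bundle ax n) (wire ax) (bundle ax n) (wire ax) := by
  have mk_shuffle := Cls.mk_cast (ax := ax) h h'
    (((idn n).par (swap 1 n)).par (idn 1))
  rw [Cls.cast_eq, Cls.mk_par, Cls.mk_par] at mk_shuffle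
  exact mk_shuffle.trans
    (Wires.tensorμ_eq_castIso (bundle ax n) (wire ax) (bundle ax n) (wire ax)).symm

instance : BimonObj (wire ax) where
  mul_comul := by
    have h := arrow_eq (ax := ax) .merge_copy
    rw [arrow_seq, arrow_seq, arrow_par, arrow_seq, arrow_par merge] at h
    exact h.trans (congrArg (fun x => (Δ[wire ax] ⊗ₘ Δ[wire ax]) ≫ x ≫ (μ[wire ax] ⊗ₘ μ[wire ax]))
      (arrow_shuffle 1 rfl rfl))
  one_comul := by
    have h := arrow_eq (ax := ax) .unit_copy
    rw [arrow_seq, arrow_par] at h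
    exact h.trans (Category.id_comp _).symm
  mul_counit := by
    have h := arrow_eq (ax := ax) .merge_discard
    rw [arrow_seq, arrow_par] at h
    exact h.trans (Category.comp_id _).symm
  one_counit := (arrow_seq _ _).symm.trans (arrow_eq .unit_discard)

/-- The endomorphism `r` of a wire. -/
def scale (ax : Rules) [IncludesPath ax] (r : ℂ) : wire ax ⟶ wire ax := arrow ax (endo r)

instance (r : ℂ) : IsBimonHom (scale ax r) where
  one_hom := (arrow_seq _ _).symm.trans (arrow_eq (.unit_endo r))
  mul_hom := by
    have h := arrow_eq (ax := ax) (.merge_endo r)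
    rw [arrow_seq, arrow_seq, arrow_par] at h
    exact h
  hom_counit := (arrow_seq _ _).symm.trans (arrow_eq (.endo_discard r))
  hom_comul := by
    have h := arrow_eq (ax := ax) (.endo_copy r)
    rw [arrow_seq, arrow_seq, arrow_par] at h
    exact h

lemma scale_scale (r s : ℂ) : scale ax r ≫ scale ax s = scale ax (r * s) :=
  (arrow_seq _ _).symm.trans (arrow_eq (.endo_mul r s))

lemma scale_zero : scale ax 0 = ε[wire ax] ≫ η[wire ax] :=
  (arrow_eq .endo_zero).trans (arrow_seq _ _)

lemma scale_one : scale ax 1 = 𝟙 (wire ax) := arrow_eq .endo_one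

lemma comul_scale_mul (r s : ℂ) :
    Δ[wire ax] ≫ (scale ax r ⊗ₘ scale ax s) ≫ μ[wire ax] = scale ax (r + s) := by
  have h := arrow_eq (ax := ax) (.endo_add r s)
  rw [arrow_seq, arrow_seq, arrow_par] at h
  exact h

/-! ### Bundles of wires -/

-- Low priority: on `wire`, these instances would compete with the monoid of the bialgebra.
instance (priority := low) bundleMonObj : (n : ℕ) → MonObj (bundle ax n)
  | 0 => inferInstanceAs (MonObj (𝟙_ (Wires ax)))
  | n + 1 =>
    letI := bundleMonObj n
    inferInstanceAs (MonObj (bundle ax n ⊗ wire ax))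

instance (priority := low) bundleIsCommMonObj : (n : ℕ) → IsCommMonObj (bundle ax n)
  | 0 => inferInstanceAs (IsCommMonObj (𝟙_ (Wires ax)))
  | n + 1 =>
    letI := bundleIsCommMonObj n
    inferInstanceAs (IsCommMonObj (bundle ax n ⊗ wire ax))

lemma mul_bundle_succ (n : ℕ) : μ[bundle ax (n + 1)]
    = tensorμ (bundle ax n) (wire ax) (bundle ax n) (wire ax) ≫ (μ[bundle ax n] ⊗ₘ μ[wire ax]) :=
  rfl

lemma one_bundle_succ (n : ℕ) : η[bundle ax (n + 1)]
    = (λ_ (𝟙_ (Wires ax))).inv ≫ (η[bundle ax n] ⊗ₘ η[wire ax]) := rfl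

lemma arrow_mergeBundle (n : ℕ) : arrow ax (mergeBundle n) = μ[bundle ax n] := by
  induction n with
  | zero => rfl
  | succ n ih =>
    rw [mul_bundle_succ, ← ih, mergeBundle, arrow_seq, arrow_shuffle, arrow_par]
    rfl

lemma arrow_units (n : ℕ) : arrow ax (units n) = η[bundle ax n] := by
  induction n with
  | zero => rfl
  | succ n ih =>
    rw [one_bundle_succ, ← ih, units, arrow_par]
    exact (Category.id_comp _).symm

/-! ### Matrices of wires -/

lemma tensorHom_mul_bundle_succ {X X' Y Y' : Wires ax} (f : X ⟶ bundle ax n) (g : Y ⟶ wire ax)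
    (f' : X' ⟶ bundle ax n) (g' : Y' ⟶ wire ax) :
    ((f ⊗ₘ g) ⊗ₘ (f' ⊗ₘ g')) ≫ μ[bundle ax (n + 1)]
      = tensorμ X Y X' Y' ≫ (((f ⊗ₘ f') ≫ μ[bundle ax n]) ⊗ₘ ((g ⊗ₘ g') ≫ μ[wire ax])) := by
  rw [mul_bundle_succ]
  refine (tensorμ_natural_assoc f g f' g' _).trans ?_
  rw [tensorHom_comp_tensorHom]

/-- A wire copied to `q` wires, the `j`-th of which is given the weight `r j`. -/
def row (ax : Rules) [IncludesPath ax] (q : ℕ) (r : Fin q → ℂ) : wire ax ⟶ bundle ax q :=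
  arrow ax ((copyN q).seq (parN q fun j => endo (r j)))

lemma row_zero (r : Fin 0 → ℂ) : row ax 0 r = ε[wire ax] :=
  (arrow_seq _ _).trans (Category.comp_id _)

lemma row_succ (q : ℕ) (r : Fin (q + 1) → ℂ) :
    row ax (q + 1) r
      = Δ[wire ax] ≫ (row ax q (fun j => r j.castSucc) ⊗ₘ scale ax (r (Fin.last q))) := by
  have copyN_succ : arrow ax (copyN (q + 1)) = Δ[wire ax] ≫ (arrow ax (copyN q) ⊗ₘ 𝟙 (wire ax)) :=
    (arrow_seq _ _).trans (congrArg (Δ[wire ax] ≫ ·) (arrow_par _ _))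
  have parN_succ : arrow ax (parN (q + 1) fun j => endo (r j))
      = arrow ax (parN q fun j => endo (r j.castSucc)) ⊗ₘ scale ax (r (Fin.last q)) :=
    arrow_par _ _
  rw [row, row, arrow_seq, arrow_seq, ← Category.id_comp (scale ax _), ← tensorHom_comp_tensorHom,
    copyN_succ, parN_succ]
  exact Category.assoc _ _ _

instance : IsMonHom Δ[wire ax] where
  one_hom := BimonObj.one_comul _
  mul_hom := BimonObj.mul_comul _

instance isMonHom_row (q : ℕ) (r : Fin q → ℂ) : IsMonHom (row ax q r) := by
  induction q with
  | zero =>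
    rw [row_zero]
    exact ⟨BimonObj.one_counit _, BimonObj.mul_counit _⟩
  | succ q ih =>
    rw [row_succ]
    exact inferInstanceAs (IsMonHom
      (Δ[wire ax] ≫ (row ax q (fun j => r j.castSucc) ⊗ₘ scale ax (r (Fin.last q)))))

lemma counit_one_bundle (q : ℕ) : ε[wire ax] ≫ η[bundle ax q] = row ax q 0 := by
  induction q with
  | zero =>
    rw [row_zero]
    exact Category.comp_id _
  | succ q ih =>
    have castSucc_zero : (fun j : Fin q => (0 : Fin (q + 1) → ℂ) j.castSucc) = 0 := rfl
    rw [row_succ, castSucc_zero, ← ih, Pi.zero_apply, scale_zero, ← tensorHom_comp_tensorHom,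
      one_bundle_succ, MonoidalCategory.tensorHom_def ε[wire ax], Category.assoc,
      ComonObj.counit_comul_assoc, ← leftUnitor_inv_naturality_assoc]

lemma scale_row (q : ℕ) (s : ℂ) (r : Fin q → ℂ) :
    scale ax s ≫ row ax q r = row ax q fun j => s * r j := by
  induction q with
  | zero => rw [row_zero, row_zero, IsComonHom.hom_counit]
  | succ q ih =>
    rw [row_succ, row_succ, IsComonHom.hom_comul_assoc, tensorHom_comp_tensorHom, ih, scale_scale]

lemma comul_row_mul (q : ℕ) (r s : Fin q → ℂ) :
    Δ[wire ax] ≫ (row ax q r ⊗ₘ row ax q s) ≫ μ[bundle ax q] = row ax q (r + s) := by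
  induction q with
  | zero =>
    rw [row_zero, row_zero, row_zero, MonoidalCategory.tensorHom_def, Category.assoc,
      ComonObj.counit_comul_assoc]
    refine ((leftUnitor_inv_naturality_assoc ε[wire ax] (λ_ (𝟙_ (Wires ax))).hom).symm).trans ?_
    rw [Iso.inv_hom_id, Category.comp_id]
  | succ q ih =>
    have castSucc_add : (fun j : Fin q => (r + s) j.castSucc)
      = (fun j => r j.castSucc) + fun j => s j.castSucc := rfl
    rw [row_succ, row_succ, row_succ, ← tensorHom_comp_tensorHom, Category.assoc,
      tensorHom_mul_bundle_succ, reassoc_of% (comul_comul_tensorμ (X := wire ax)),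
      tensorHom_comp_tensorHom, castSucc_add, ← ih, Pi.add_apply, ← comul_scale_mul]

/-- The bipartite diagram of wires weighted by the entries of a matrix. -/
def matrixWires (ax : Rules) [IncludesPath ax] (p q : ℕ) (M : Fin p → Fin q → ℂ) :
    bundle ax p ⟶ bundle ax q := arrow ax (wires p q fun i j => endo (M i j))

lemma matrixWires_zero (q : ℕ) (M : Fin 0 → Fin q → ℂ) : matrixWires ax 0 q M = η[bundle ax q] :=
  arrow_units q

lemma matrixWires_succ (p q : ℕ) (M : Fin (p + 1) → Fin q → ℂ) :
    matrixWires ax (p + 1) q M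
      = (matrixWires ax p q (fun i => M i.castSucc) ⊗ₘ row ax q (M (Fin.last p))) ≫
          μ[bundle ax q] := by
  rw [matrixWires, wires, arrow_seq, arrow_par, arrow_mergeBundle]
  rfl

lemma matrixWires_one (q : ℕ) (M : Fin 1 → Fin q → ℂ) : matrixWires ax 1 q M = row ax q (M 0) := by
  have one_mul_row := matrixWires_succ (ax := ax) 0 q M
  rw [matrixWires_zero, MonoidalCategory.tensorHom_def, ← whisker_exchange, Category.assoc,
    MonObj.one_mul] at one_mul_row
  exact one_mul_row.trans ((leftUnitor_naturality _).trans (Category.id_comp _))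

lemma tensorHom_mul_assoc {C : Type*} [Category C] [MonoidalCategory C] {A X Y Z : C} [MonObj A]
    (f : X ⟶ A) (g : Y ⟶ A) (h : Z ⟶ A) :
    (((f ⊗ₘ g) ≫ μ[A]) ⊗ₘ h) ≫ μ[A]
      = (α_ X Y Z).hom ≫ (f ⊗ₘ ((g ⊗ₘ h) ≫ μ[A])) ≫ μ[A] := by
  rw [← Category.comp_id h, ← tensorHom_comp_tensorHom, tensorHom_id, Category.assoc,
    MonObj.mul_assoc, associator_naturality_assoc, Category.comp_id, ← Category.comp_id f,
    ← tensorHom_comp_tensorHom, id_tensorHom, Category.comp_id, Category.assoc]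

lemma matrixWires_add (q : ℕ) (M : Fin (n + n') → Fin q → ℂ) :
    matrixWires ax (n + n') q M
      = (matrixWires ax n q (fun i => M (Fin.castAdd n' i)) ⊗ₘ
          matrixWires ax n' q (fun i => M (Fin.natAdd n i))) ≫ μ[bundle ax q] := by
  induction n' with
  | zero =>
    rw [matrixWires_zero, MonoidalCategory.tensorHom_def, Category.assoc, MonObj.mul_one]
    exact ((rightUnitor_naturality (matrixWires ax n q M)).trans (Category.id_comp _)).symm
  | succ n' ih =>
    refine (matrixWires_succ (n + n') q M).trans ?_
    rw [ih, matrixWires_succ, tensorHom_mul_assoc]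
    exact Category.id_comp _

lemma matrixWires_append {q : ℕ} (M : Fin n → Fin q → ℂ) (M' : Fin n' → Fin q → ℂ) :
    (matrixWires ax n q M ⊗ₘ matrixWires ax n' q M') ≫ μ[bundle ax q]
      = matrixWires ax (n + n') q (Fin.append M M') := by
  rw [matrixWires_add]
  simp only [Fin.append_left, Fin.append_right]

/-- The morphisms that turn matrices of wires into matrices of wires. -/
def Absorbs {X Y : Wires ax} (f : X ⟶ Y) : Prop :=
  ∀ q M, ∃ N, f ≫ matrixWires ax Y.num q M = matrixWires ax X.num q N

namespace Absorbs

variable {X Y Z X' Y' : Wires ax}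

lemma id (X : Wires ax) : Absorbs (𝟙 X) := fun _ M => ⟨M, Category.id_comp _⟩

lemma comp {f : X ⟶ Y} {g : Y ⟶ Z} (hf : Absorbs f) (hg : Absorbs g) : Absorbs (f ≫ g) :=
  fun q L => by
  obtain ⟨M, hM⟩ := hg q L
  obtain ⟨N, hN⟩ := hf q M
  exact ⟨N, by rw [Category.assoc, hM, hN]⟩

lemma tensor {f : X ⟶ Y} {g : X' ⟶ Y'} (hf : Absorbs f) (hg : Absorbs g) : Absorbs (f ⊗ₘ g) :=
  fun q M => by
  obtain ⟨N, hN⟩ := hf q fun i => M (Fin.castAdd Y'.num i)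
  obtain ⟨N', hN'⟩ := hg q fun i => M (Fin.natAdd Y.num i)
  refine ⟨Fin.append N N', ?_⟩
  refine (congrArg ((f ⊗ₘ g) ≫ ·) (matrixWires_add q M)).trans ?_
  refine (tensorHom_comp_tensorHom_assoc _ _ _ _ _).trans ?_
  rw [hN, hN']
  exact matrixWires_append N N'

lemma whiskerLeft (X : Wires ax) {f : Y ⟶ Z} (hf : Absorbs f) : Absorbs (X ◁ f) := by
  rw [← id_tensorHom]
  exact (id X).tensor hf

lemma whiskerRight {f : Y ⟶ Z} (hf : Absorbs f) (X : Wires ax) : Absorbs (f ▷ X) := by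
  rw [← tensorHom_id]
  exact hf.tensor (id X)

lemma castIso (X Y : Wires ax) (h : X.num = Y.num) : Absorbs (Wires.castIso X Y h).hom := by
  obtain ⟨m⟩ := X
  obtain ⟨n⟩ := Y
  obtain rfl : m = n := h
  exact id _

lemma associator (X Y Z : Wires ax) : Absorbs (α_ X Y Z).hom := castIso _ _ _

lemma associator_inv (X Y Z : Wires ax) : Absorbs (α_ X Y Z).inv :=
  castIso _ _ (Nat.add_assoc _ _ _).symm

lemma leftUnitor (X : Wires ax) : Absorbs (λ_ X).hom := castIso _ _ _

lemma leftUnitor_inv (X : Wires ax) : Absorbs (λ_ X).inv := castIso _ _ (Nat.zero_add _).symm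

lemma rightUnitor (X : Wires ax) : Absorbs (ρ_ X).hom := castIso _ _ _

lemma rightUnitor_inv (X : Wires ax) : Absorbs (ρ_ X).inv := castIso _ _ (Nat.add_zero _).symm

lemma braiding (X Y : Wires ax) : Absorbs (β_ X Y).hom := fun q M => by
  refine ⟨Fin.append (fun i => M (Fin.natAdd Y.num i)) fun i => M (Fin.castAdd X.num i), ?_⟩
  refine (congrArg ((β_ X Y).hom ≫ ·) (matrixWires_add q M)).trans ?_
  refine (BraidedCategory.braiding_naturality_assoc _ _ _).symm.trans ?_
  rw [IsCommMonObj.mul_comm]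
  exact matrixWires_append _ _

lemma scale (r : ℂ) : Absorbs (scale ax r) := fun q M =>
  ⟨_, (congrArg (QPath.scale ax r ≫ ·) (matrixWires_one q M)).trans <|
    (scale_row q r (M 0)).trans (matrixWires_one q fun _ j => r * M 0 j).symm⟩

lemma mul : Absorbs μ[wire ax] := fun q M =>
  ⟨_, (congrArg (μ[wire ax] ≫ ·) (matrixWires_one q M)).trans <|
    (IsMonHom.mul_hom _).trans <| by rw [← matrixWires_one q M]; exact matrixWires_append M M⟩

lemma one : Absorbs η[wire ax] := fun q M =>
  ⟨Fin.elim0, (congrArg (η[wire ax] ≫ ·) (matrixWires_one q M)).trans <|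
    (IsMonHom.one_hom _).trans (matrixWires_zero q _).symm⟩

lemma comul : Absorbs Δ[wire ax] := fun q M => by
  let N : Fin 1 → Fin q → ℂ := fun _ => M (Fin.castAdd 1 0) + M (Fin.natAdd 1 0)
  refine ⟨N, (congrArg (Δ[wire ax] ≫ ·) (matrixWires_add (n := 1) (n' := 1) q M)).trans ?_⟩
  rw [matrixWires_one, matrixWires_one]
  exact (comul_row_mul q _ _).trans (matrixWires_one q N).symm

lemma counit : Absorbs ε[wire ax] := fun q M =>
  ⟨_, (congrArg (ε[wire ax] ≫ ·) (matrixWires_zero q M)).trans <|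
    (counit_one_bundle q).trans (matrixWires_one q fun _ => 0).symm⟩

lemma mergeN (n : ℕ) : Absorbs (arrow ax (mergeN n)) := by
  induction n with
  | zero => exact one
  | succ n ih =>
    rw [Diag.mergeN, arrow_seq, arrow_par]
    exact (ih.tensor (id _)).comp mul

lemma copyN (n : ℕ) : Absorbs (arrow ax (copyN n)) := by
  induction n with
  | zero => exact counit
  | succ n ih =>
    rw [Diag.copyN, arrow_seq, arrow_par]
    exact comul.comp (ih.tensor (id _))

end Absorbs

lemma row_snoc_zero {q : ℕ} (r : Fin q → ℂ) :
    row ax (q + 1) (Fin.snoc r 0 : Fin (q + 1) → ℂ)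
      = (ρ_ (wire ax)).inv ≫ (row ax q r ⊗ₘ η[wire ax]) := by
  rw [row_succ]
  simp only [Fin.snoc_castSucc, Fin.snoc_last]
  rw [scale_zero, ← Category.id_comp (row ax q r), ← tensorHom_comp_tensorHom, id_tensorHom,
    ComonObj.comul_counit_assoc, Category.id_comp]

lemma row_snoc_one (q : ℕ) :
    row ax (q + 1) (Fin.snoc (0 : Fin q → ℂ) 1 : Fin (q + 1) → ℂ)
      = (λ_ (wire ax)).inv ≫ (η[bundle ax q] ⊗ₘ 𝟙 (wire ax)) := by
  rw [row_succ]
  simp only [Fin.snoc_castSucc, Fin.snoc_last]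
  rw [show (fun j => (0 : Fin q → ℂ) j) = 0 from rfl, ← counit_one_bundle, scale_one, tensorHom_id,
    tensorHom_id, comp_whiskerRight, ComonObj.counit_comul_assoc]

lemma matrixWires_snoc_zero {p q : ℕ} (M : Fin p → Fin q → ℂ) :
    matrixWires ax p (q + 1) (fun i => Fin.snoc (M i) 0)
      = (ρ_ (bundle ax p)).inv ≫ (matrixWires ax p q M ⊗ₘ η[wire ax]) := by
  induction p with
  | zero =>
    rw [matrixWires_zero, matrixWires_zero, one_bundle_succ]
    rfl
  | succ p ih =>
    have one_mul_one : (η[wire ax] ⊗ₘ η[wire ax]) ≫ μ[wire ax]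
        = (λ_ (𝟙_ (Wires ax))).hom ≫ η[wire ax] := by
      rw [tensorHom_def', Category.assoc, MonObj.one_mul, leftUnitor_naturality]
    rw [matrixWires_succ, ih fun i => M i.castSucc, row_snoc_zero, ← tensorHom_comp_tensorHom,
      Category.assoc, tensorHom_mul_bundle_succ, one_mul_one,
      reassoc_of% (rightUnitor_inv_tensorμ (bundle ax p) (wire ax)), matrixWires_succ,
      ← id_tensorHom, tensorHom_comp_tensorHom, Category.id_comp, Iso.inv_hom_id_assoc]
    rfl

lemma matrixWires_tensor_id {p q : ℕ} (M : Fin p → Fin q → ℂ) :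
    matrixWires ax (p + 1) (q + 1) (Fin.snoc (fun i => Fin.snoc (M i) 0) (Fin.snoc 0 1))
      = matrixWires ax p q M ⊗ₘ 𝟙 (wire ax) := by
  rw [matrixWires_succ]
  simp only [Fin.snoc_castSucc, Fin.snoc_last]
  rw [matrixWires_snoc_zero, row_snoc_one, ← tensorHom_comp_tensorHom, Category.assoc,
    tensorHom_mul_bundle_succ,
    reassoc_of% (rightUnitor_leftUnitor_inv_tensorμ (bundle ax p) (wire ax)),
    tensorHom_comp_tensorHom, tensorHom_id, MonObj.one_mul, Iso.inv_hom_id, tensorHom_id,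
    MonoidalCategory.tensorHom_def, Category.assoc, MonObj.mul_one, rightUnitor_naturality,
    Iso.inv_hom_id_assoc, tensorHom_id]

lemma exists_matrixWires_eq_id (k : ℕ) : ∃ M, matrixWires ax k k M = 𝟙 (bundle ax k) := by
  induction k with
  | zero => exact ⟨Fin.elim0, matrixWires_zero 0 _⟩
  | succ k ih =>
    obtain ⟨M, hM⟩ := ih
    refine ⟨_, (matrixWires_tensor_id M).trans ?_⟩
    rw [hM, id_tensorHom_id]
    rfl

lemma Absorbs.exists_eq_matrixWires {X Y : Wires ax} {f : X ⟶ Y} (hf : Absorbs f) :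
    ∃ M, f = matrixWires ax X.num Y.num M := by
  obtain ⟨I, hI⟩ := exists_matrixWires_eq_id (ax := ax) Y.num
  obtain ⟨M, hM⟩ := hf _ I
  exact ⟨M, ((congrArg (f ≫ ·) hI).trans (Category.comp_id f)).symm.trans hM⟩

/-! ### Existence of normal forms -/

/-- The preparation of one photon. -/
def prep (ax : Rules) [IncludesPath ax] : 𝟙_ (Wires ax) ⟶ wire ax := arrow ax (create 1)

/-- The annihilation of one photon. -/
def annih (ax : Rules) [IncludesPath ax] : wire ax ⟶ 𝟙_ (Wires ax) := arrow ax (annihilate 1)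

/-- The preparation of one photon on each of `n` wires. -/
def preps (ax : Rules) [IncludesPath ax] (n : ℕ) : 𝟙_ (Wires ax) ⟶ bundle ax n :=
  arrow ax (creates n)

/-- The annihilation of one photon on each of `n` wires. -/
def annihs (ax : Rules) [IncludesPath ax] (n : ℕ) : bundle ax n ⟶ 𝟙_ (Wires ax) :=
  arrow ax (annihilates n)

lemma preps_succ (n : ℕ) :
    preps ax (n + 1) = (λ_ (𝟙_ (Wires ax))).inv ≫ (preps ax n ⊗ₘ prep ax) :=
  (arrow_par (creates n) (create 1)).trans (Category.id_comp _).symm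

lemma annihs_succ (n : ℕ) :
    annihs ax (n + 1) = (annihs ax n ⊗ₘ annih ax) ≫ (λ_ (𝟙_ (Wires ax))).hom :=
  (arrow_par (annihilates n) (annihilate 1)).trans (Category.comp_id _).symm

lemma preps_succ_braiding (n : ℕ) : preps ax (n + 1) ≫ (β_ (bundle ax n) (wire ax)).hom
    = (λ_ (𝟙_ (Wires ax))).inv ≫ (prep ax ⊗ₘ preps ax n) := by
  rw [preps_succ, Category.assoc, BraidedCategory.braiding_naturality, braiding_tensorUnit_left,
    unitors_equal, Category.assoc, Iso.hom_inv_id_assoc]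

lemma whiskerLeft_prep_preps (S : Wires ax) (a : ℕ) :
    S ◁ prep ax ≫ (ρ_ (S ⊗ wire ax)).inv ≫ (S ⊗ wire ax) ◁ preps ax a
      = (ρ_ (S ⊗ 𝟙_ (Wires ax))).inv ≫ (S ⊗ 𝟙_ (Wires ax)) ◁ preps ax (a + 1) ≫
          (ρ_ S).hom ▷ bundle ax (a + 1) ≫ S ◁ (β_ (bundle ax a) (wire ax)).hom ≫
            (α_ S (wire ax) (bundle ax a)).inv := by
  have braid_preps : S ◁ preps ax (a + 1) ≫ S ◁ (β_ (bundle ax a) (wire ax)).hom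
      = S ◁ ((λ_ (𝟙_ (Wires ax))).inv ≫ (prep ax ⊗ₘ preps ax a)) := by
    rw [← preps_succ_braiding]
    exact (MonoidalCategory.whiskerLeft_comp ..).symm
  rw [whisker_exchange_assoc, reassoc_of% braid_preps, MonoidalCategory.tensorHom_def]
  monoidal

lemma whiskerRight_annihs_succ {X : Wires ax} (f : X ⟶ bundle ax k) :
    f ▷ wire ax ≫ annihs ax (k + 1) = X ◁ annih ax ≫ (ρ_ X).hom ≫ f ≫ annihs ax k := by
  rw [annihs_succ, tensorHom_def', unitors_equal, Category.assoc, rightUnitor_naturality,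
    ← whisker_exchange_assoc, rightUnitor_naturality_assoc]

lemma braiding_whiskerLeft_annih (S A : Wires ax) :
    (α_ S (wire ax) A).hom ≫ S ◁ (β_ (wire ax) A).hom ≫ (α_ S A (wire ax)).inv ≫
        (S ⊗ A) ◁ annih ax ≫ (ρ_ (S ⊗ A)).hom
      = (S ◁ annih ax) ▷ A ≫ (ρ_ S).hom ▷ A := by
  rw [tensor_whiskerLeft]
  simp only [Category.assoc, Iso.inv_hom_id_assoc]
  rw [← whiskerLeft_comp_assoc, ← BraidedCategory.braiding_naturality_left,
    braiding_tensorUnit_left]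
  monoidal

/-- The effects that prepare auxiliary photons, apply a morphism that absorbs matrices, and
annihilate one photon on every remaining wire. -/
def NormalEffect {X : Wires ax} (x : X ⟶ 𝟙_ (Wires ax)) : Prop :=
  ∃ (a k : ℕ) (e : X ⊗ bundle ax a ⟶ bundle ax k), Absorbs e ∧
    x = (ρ_ X).inv ≫ X ◁ preps ax a ≫ e ≫ annihs ax k

namespace NormalEffect

lemma of_absorbs {X : Wires ax} {f : X ⟶ 𝟙_ (Wires ax)} (hf : Absorbs f) : NormalEffect f := by
  refine ⟨0, 0, (ρ_ X).hom ≫ f, (Absorbs.rightUnitor X).comp hf, ?_⟩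
  have whiskerLeft_preps_zero : X ◁ preps ax 0 = 𝟙 (X ⊗ 𝟙_ (Wires ax)) :=
    MonoidalCategory.whiskerLeft_id X (𝟙_ (Wires ax))
  rw [whiskerLeft_preps_zero, Category.id_comp, Category.assoc, Iso.inv_hom_id_assoc]
  exact (Category.comp_id f).symm

lemma comp {X Y : Wires ax} {f : X ⟶ Y} (hf : Absorbs f) {x : Y ⟶ 𝟙_ (Wires ax)}
    (hx : NormalEffect x) : NormalEffect (f ≫ x) := by
  obtain ⟨a, k, e, he, rfl⟩ := hx
  refine ⟨a, k, f ▷ bundle ax a ≫ e, (hf.whiskerRight _).comp he, ?_⟩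
  rw [Category.assoc, whisker_exchange_assoc, ← rightUnitor_inv_naturality_assoc]

lemma prep_comp {S : Wires ax} {x : S ⊗ wire ax ⟶ 𝟙_ (Wires ax)} (hx : NormalEffect x) :
    NormalEffect (S ◁ prep ax ≫ x) := by
  obtain ⟨a, k, e, he, rfl⟩ := hx
  refine ⟨a + 1, k, (ρ_ S).hom ▷ bundle ax (a + 1) ≫ S ◁ (β_ (bundle ax a) (wire ax)).hom ≫
    (α_ S (wire ax) (bundle ax a)).inv ≫ e, ?_, ?_⟩
  · exact ((Absorbs.rightUnitor S).whiskerRight _).comp <|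
      ((Absorbs.braiding _ _).whiskerLeft S).comp <| (Absorbs.associator_inv _ _ _).comp he
  · simp only [reassoc_of% (whiskerLeft_prep_preps S a), Category.assoc]

lemma annih_comp {S : Wires ax} {x : S ⊗ 𝟙_ (Wires ax) ⟶ 𝟙_ (Wires ax)}
    (hx : NormalEffect x) : NormalEffect (S ◁ annih ax ≫ x) := by
  obtain ⟨a, k, e, he, rfl⟩ := hx
  refine ⟨a, k + 1, (α_ S (wire ax) (bundle ax a)).hom ≫ S ◁ (β_ (wire ax) (bundle ax a)).hom ≫
    (α_ S (bundle ax a) (wire ax)).inv ≫ ((ρ_ S).inv ▷ bundle ax a ≫ e) ▷ wire ax, ?_, ?_⟩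
  · exact (Absorbs.associator _ _ _).comp <| ((Absorbs.braiding _ _).whiskerLeft S).comp <|
      (Absorbs.associator_inv _ _ _).comp <|
        (((Absorbs.rightUnitor_inv S).whiskerRight _).comp he).whiskerRight _
  · simp only [Category.assoc]
    rw [whiskerRight_annihs_succ, reassoc_of% (braiding_whiskerLeft_annih S (bundle ax a)),
      Category.assoc, hom_inv_whiskerRight_assoc, whisker_exchange_assoc,
      rightUnitor_inv_naturality_assoc]

lemma exists_eq_matrixWires {x : 𝟙_ (Wires ax) ⟶ 𝟙_ (Wires ax)} (hx : NormalEffect x) :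
    ∃ (a k : ℕ) (M : Fin a → Fin k → ℂ),
      x = preps ax a ≫ matrixWires ax a k M ≫ annihs ax k := by
  obtain ⟨a, k, e, he, rfl⟩ := hx
  obtain ⟨M, hM⟩ := ((Absorbs.leftUnitor_inv _).comp he).exists_eq_matrixWires
  refine ⟨a, k, M, ?_⟩
  rw [← hM, ← unitors_inv_equal, ← leftUnitor_inv_naturality_assoc, Category.assoc]

end NormalEffect

/-- Precomposition with `f` multiplies the effects by `c`, up to normal effects. -/
def Scales (c : ℂ) {X Y : Wires ax} (f : X ⟶ Y) : Prop :=
  ∀ (S : Wires ax) (x : S ⊗ Y ⟶ 𝟙_ (Wires ax)), NormalEffect x →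
    ∃ y : S ⊗ X ⟶ 𝟙_ (Wires ax), NormalEffect y ∧ S ◁ f ≫ x = c • y

lemma Absorbs.scales {X Y : Wires ax} {f : X ⟶ Y} (hf : Absorbs f) : Scales 1 f :=
  fun S x hx => ⟨S ◁ f ≫ x, hx.comp (hf.whiskerLeft S), (one_smul ℂ _).symm⟩

namespace Scales

variable {X Y Z X' Y' : Wires ax} {c c' : ℂ}

lemma prep : Scales 1 (prep ax) := fun _ _ hx => ⟨_, hx.prep_comp, (one_smul ℂ _).symm⟩

lemma annih : Scales 1 (annih ax) := fun _ _ hx => ⟨_, hx.annih_comp, (one_smul ℂ _).symm⟩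

lemma comp {f : X ⟶ Y} {g : Y ⟶ Z} (hf : Scales c f) (hg : Scales c' g) :
    Scales (c * c') (f ≫ g) := fun S x hx => by
  obtain ⟨y, hy, g_comp_x⟩ := hg S x hx
  obtain ⟨z, hz, f_comp_y⟩ := hf S y hy
  refine ⟨z, hz, ?_⟩
  rw [MonoidalCategory.whiskerLeft_comp, Category.assoc, g_comp_x, Linear.comp_smul, f_comp_y,
    smul_smul, mul_comm]

lemma smul {f : X ⟶ Y} (hf : Scales c f) (c' : ℂ) : Scales (c' * c) (c' • f) := fun S x hx => by
  obtain ⟨y, hy, f_comp_x⟩ := hf S x hx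
  exact ⟨y, hy, by rw [MonoidalLinear.whiskerLeft_smul, Linear.smul_comp, f_comp_x, smul_smul]⟩

lemma whiskerLeft (Z : Wires ax) {f : X ⟶ Y} (hf : Scales c f) : Scales c (Z ◁ f) :=
  fun S x hx => by
  obtain ⟨y, hy, f_comp_x⟩ := hf (S ⊗ Z) ((α_ S Z Y).hom ≫ x) (hx.comp (.associator _ _ _))
  refine ⟨(α_ S Z X).inv ≫ y, hy.comp (.associator_inv _ _ _), ?_⟩
  rw [← Linear.comp_smul, ← f_comp_x, associator_naturality_right_assoc, Iso.inv_hom_id_assoc]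

lemma whiskerRight (Z : Wires ax) {f : X ⟶ Y} (hf : Scales c f) : Scales c (f ▷ Z) := by
  have conj_braiding := ((Absorbs.braiding X Z).scales.comp (hf.whiskerLeft Z)).comp
    (Absorbs.braiding Z Y).scales
  rwa [Category.assoc, BraidedCategory.braiding_naturality_right,
    SymmetricCategory.symmetry_assoc, _root_.one_mul, _root_.mul_one] at conj_braiding

lemma tensor {f : X ⟶ Y} {g : X' ⟶ Y'} (hf : Scales c f) (hg : Scales c' g) :
    Scales (c * c') (f ⊗ₘ g) := by
  rw [MonoidalCategory.tensorHom_def]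
  exact (hf.whiskerRight _).comp (hg.whiskerLeft _)

lemma preps (n : ℕ) : Scales 1 (preps ax n) := by
  induction n with
  | zero => exact (Absorbs.id _).scales
  | succ n ih =>
    rw [preps_succ]
    simpa using (Absorbs.leftUnitor_inv _).scales.comp (ih.tensor prep)

lemma annihs (n : ℕ) : Scales 1 (annihs ax n) := by
  induction n with
  | zero => exact (Absorbs.id _).scales
  | succ n ih =>
    rw [annihs_succ]
    simpa using (ih.tensor annih).comp (Absorbs.leftUnitor _).scales

end Scales

lemma arrow_create (n : ℕ+) : arrow @NormAxiom (create n)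
    = (1 / (Real.sqrt (Nat.factorial n) : ℂ)) • (preps _ n ≫ arrow _ (mergeN n)) :=
  (Cls.ofLin_eq_iff.mpr (.rule (.create_norm n))).trans <|
    congrArg ((1 / (Real.sqrt (Nat.factorial n) : ℂ)) • ·) (arrow_seq (creates n) (mergeN n))

lemma arrow_annihilate (n : ℕ+) : arrow @NormAxiom (annihilate n)
    = (1 / (Real.sqrt (Nat.factorial n) : ℂ)) • (arrow _ (copyN n) ≫ annihs _ n) :=
  (Cls.ofLin_eq_iff.mpr (.rule (.annihilate_norm n))).trans <|
    congrArg ((1 / (Real.sqrt (Nat.factorial n) : ℂ)) • ·) (arrow_seq (copyN n) (annihilates n))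

lemma scales_normFactor (d : Diag m n) : Scales d.normFactor (arrow @NormAxiom d) := by
  induction d with
  | idn n => exact (Absorbs.id _).scales
  | seq f g hf hg => rw [arrow_seq]; exact hf.comp hg
  | par f g hf hg => rw [arrow_par]; exact hf.tensor hg
  | swap m n => exact (Absorbs.braiding (bundle _ m) (bundle _ n)).scales
  | copy => exact Absorbs.comul.scales
  | discard => exact Absorbs.counit.scales
  | merge => exact Absorbs.mul.scales
  | unit => exact Absorbs.one.scales
  | endo r => exact (Absorbs.scale r).scales
  | create n =>
    rw [arrow_create]
    simpa [normFactor] using ((Scales.preps n).comp (Absorbs.mergeN n).scales).smul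
      (1 / (Real.sqrt (Nat.factorial n) : ℂ))
  | annihilate n =>
    rw [arrow_annihilate]
    simpa [normFactor] using ((Absorbs.copyN n).scales.comp (Scales.annihs n)).smul
      (1 / (Real.sqrt (Nat.factorial n) : ℂ))

namespace WeightedBipartiteGraph

/-- The complete bipartite graph with a given matrix of weights. -/
def ofMatrix {p q : ℕ} (M : Fin p → Fin q → ℂ) : WeightedBipartiteGraph p q where
  graph := completeBipartiteGraph (Fin p) (Fin q)
  bipartite := le_rfl
  weight e := Sym2.lift ⟨fun u v => match u, v with
    | .inl i, .inr j => M i j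
    | .inr j, .inl i => M i j
    | .inl _, .inl _ => 0
    | .inr _, .inr _ => 0, fun u v => by cases u <;> cases v <;> rfl⟩ e.1

lemma diagram_ofMatrix {p q : ℕ} (M : Fin p → Fin q → ℂ) :
    (ofMatrix M).diagram
      = (creates p).seq ((wires p q fun i j => endo (M i j)).seq (annihilates q)) := by
  have adj (i : Fin p) (j : Fin q) : (ofMatrix M).graph.Adj (Sum.inl i) (Sum.inr j) := by
    simp [ofMatrix]
  simp only [diagram, adj, ↓reduceDIte]
  rfl

end WeightedBipartiteGraph

lemma arrow_diagram_ofMatrix {p q : ℕ} (M : Fin p → Fin q → ℂ) :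
    arrow ax (WeightedBipartiteGraph.ofMatrix M).diagram
      = preps ax p ≫ matrixWires ax p q M ≫ annihs ax q := by
  rw [WeightedBipartiteGraph.diagram_ofMatrix]
  exact (arrow_seq _ _).trans (congrArg (preps ax p ≫ ·) (arrow_seq _ _))

theorem exists_isNormalForm_ofMatrix (d : Diag 0 0) : ∃ (p q : ℕ) (M : Fin p → Fin q → ℂ),
    IsNormalForm d (.ofMatrix M) d.normFactor := by
  obtain ⟨y, hy, arrow_comp⟩ := scales_normFactor d (𝟙_ _) (λ_ (𝟙_ (Wires @NormAxiom))).hom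
    (.of_absorbs (.leftUnitor _))
  obtain ⟨p, q, M, hM⟩ := (hy.comp (.leftUnitor_inv (𝟙_ (Wires @NormAxiom)))).exists_eq_matrixWires
  have arrow_d : arrow @NormAxiom d
      = d.normFactor • arrow _ (WeightedBipartiteGraph.ofMatrix M).diagram := by
    rw [leftUnitor_naturality] at arrow_comp
    rw [arrow_diagram_ofMatrix, ← hM, ← Linear.comp_smul, ← arrow_comp]
    exact (Iso.inv_hom_id_assoc (λ_ (𝟙_ (Wires @NormAxiom))) (arrow _ d)).symm
  exact ⟨p, q, M, Cls.ofLin_eq_iff.mp (arrow_d.trans (map_smul (Cls.ofLin _) _ _).symm)⟩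

/-! ### Rewriting closed diagrams to scalars -/

section MulRight

variable {C : Type*} [Category C] [MonoidalCategory C] {X Y : C}

/-- Right multiplication of a monoid by one of its elements. -/
def mulRight [MonObj X] (v : 𝟙_ C ⟶ X) : X ⟶ X := (ρ_ X).inv ≫ X ◁ v ≫ μ[X]

lemma mulRight_one [MonObj X] : mulRight η[X] = 𝟙 X := by
  rw [mulRight, MonObj.mul_one, Iso.inv_hom_id]

lemma leftUnitor_inv_tensorHom_mul [MonObj X] (u v : 𝟙_ C ⟶ X) :
    (λ_ (𝟙_ C)).inv ≫ (u ⊗ₘ v) ≫ μ[X] = u ≫ mulRight v := by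
  rw [mulRight, MonoidalCategory.tensorHom_def, unitors_inv_equal, Category.assoc,
    rightUnitor_inv_naturality_assoc]

lemma rightUnitor_inv_whiskerLeft_tensorHom (v : 𝟙_ C ⟶ Y) (f : X ⟶ 𝟙_ C) (g : Y ⟶ 𝟙_ C) :
    (ρ_ X).inv ≫ X ◁ v ≫ (f ⊗ₘ g) ≫ (λ_ (𝟙_ C)).hom = f ≫ v ≫ g := by
  rw [MonoidalCategory.tensorHom_def, Category.assoc, whisker_exchange_assoc,
    leftUnitor_naturality, leftUnitor_naturality_assoc, ← rightUnitor_inv_naturality_assoc,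
    unitors_equal, Iso.inv_hom_id_assoc]

lemma mulRight_tensor [BraidedCategory C] [MonObj X] [MonObj Y] (v : 𝟙_ C ⟶ X) (w : 𝟙_ C ⟶ Y) :
    mulRight ((λ_ (𝟙_ C)).inv ≫ (v ⊗ₘ w)) = mulRight v ⊗ₘ mulRight w := by
  have unitors_tensorμ : (ρ_ (X ⊗ Y)).inv ≫ (X ⊗ Y) ◁ (λ_ (𝟙_ C)).inv ≫ tensorμ X Y (𝟙_ C) (𝟙_ C)
      = (ρ_ X).inv ⊗ₘ (ρ_ Y).inv := by
    simp only [tensorμ, braiding_tensorUnit_right]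
    monoidal
  rw [mulRight, mulRight, mulRight, MonObj.tensorObj.mul_def, MonoidalCategory.whiskerLeft_comp,
    Category.assoc, tensorμ_natural_right_assoc, reassoc_of% unitors_tensorμ,
    tensorHom_comp_tensorHom, tensorHom_comp_tensorHom]

lemma mulRight_add [Preadditive C] [MonoidalPreadditive C] [MonObj X] (v w : 𝟙_ C ⟶ X) :
    mulRight (v + w) = mulRight v + mulRight w := by
  simp only [mulRight, MonoidalPreadditive.whiskerLeft_add, Preadditive.add_comp,
    Preadditive.comp_add]

lemma mulRight_zero [Preadditive C] [MonoidalPreadditive C] [MonObj X] :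
    mulRight (0 : 𝟙_ C ⟶ X) = 0 := by
  simp only [mulRight, MonoidalPreadditive.whiskerLeft_zero, Limits.zero_comp, Limits.comp_zero]

end MulRight

section Branching

lemma prep_comul : prep @QPathAxiom ≫ Δ[wire _]
    = (λ_ (𝟙_ (Wires _))).inv ≫ (prep _ ⊗ₘ η[wire _]) +
        (λ_ (𝟙_ (Wires _))).inv ≫ (η[wire _] ⊗ₘ prep _) := by
  have create_branch := (Cls.ofLin_eq_iff.mpr (.rule .create_branch)).trans
    (map_add (Cls.ofLin @QPathAxiom) _ _)
  refine (arrow_seq _ _).symm.trans (create_branch.trans ?_)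
  exact congrArg₂ (· + ·) ((arrow_par _ _).trans (Category.id_comp _).symm)
    ((arrow_par _ _).trans (Category.id_comp _).symm)

lemma mul_annih : μ[wire _] ≫ annih @QPathAxiom
    = (annih _ ⊗ₘ ε[wire _]) ≫ (λ_ (𝟙_ (Wires _))).hom +
        (ε[wire _] ⊗ₘ annih _) ≫ (λ_ (𝟙_ (Wires _))).hom := by
  have annihilate_branch := (Cls.ofLin_eq_iff.mpr (.rule .annihilate_branch)).trans
    (map_add (Cls.ofLin @QPathAxiom) _ _)
  refine (arrow_seq _ _).symm.trans (annihilate_branch.trans ?_)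
  exact congrArg₂ (· + ·) ((arrow_par _ _).trans (Category.comp_id _).symm)
    ((arrow_par _ _).trans (Category.comp_id _).symm)

lemma prep_counit : prep @QPathAxiom ≫ ε[wire _] = 0 :=
  (arrow_seq _ _).symm.trans <|
    (Cls.ofLin_eq_iff.mpr (.rule .create_discard)).trans (map_zero (Cls.ofLin _))

lemma one_annih : η[wire _] ≫ annih @QPathAxiom = 0 :=
  (arrow_seq _ _).symm.trans <|
    (Cls.ofLin_eq_iff.mpr (.rule .unit_annihilate)).trans (map_zero (Cls.ofLin _))

lemma prep_scale_annih (s : ℂ) :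
    prep @QPathAxiom ≫ scale _ s ≫ annih _ = s • 𝟙 (𝟙_ (Wires _)) := by
  have scalar := (Cls.ofLin_eq_iff.mpr (.rule (.scalar s))).trans
    (map_smul (Cls.ofLin @QPathAxiom) s _)
  exact ((arrow_seq _ _).trans (congrArg (prep _ ≫ ·) (arrow_seq _ _))).symm.trans scalar

lemma prep_row_succ (q : ℕ) (r : Fin (q + 1) → ℂ) : prep @QPathAxiom ≫ row _ (q + 1) r
    = (λ_ (𝟙_ (Wires _))).inv ≫ ((prep _ ≫ row _ q fun j => r j.castSucc) ⊗ₘ η[wire _]) +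
        (λ_ (𝟙_ (Wires _))).inv ≫
          (η[bundle _ q] ⊗ₘ (prep _ ≫ scale _ (r (Fin.last q)))) := by
  rw [row_succ, ← Category.assoc, prep_comul, Preadditive.add_comp, Category.assoc, Category.assoc,
    tensorHom_comp_tensorHom, tensorHom_comp_tensorHom, IsMonHom.one_hom, IsMonHom.one_hom]

lemma mulRight_prep_row_zero (r : Fin 0 → ℂ) :
    mulRight (prep @QPathAxiom ≫ row _ 0 r) = 0 := by
  rw [row_zero, prep_counit]
  exact mulRight_zero

lemma mulRight_prep_row_succ (q : ℕ) (r : Fin (q + 1) → ℂ) :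
    mulRight (prep @QPathAxiom ≫ row _ (q + 1) r)
      = (mulRight (prep _ ≫ row _ q fun j => r j.castSucc) ⊗ₘ 𝟙 (wire _)) +
          (𝟙 (bundle _ q) ⊗ₘ mulRight (prep _ ≫ scale _ (r (Fin.last q)))) := by
  rw [prep_row_succ, ← mulRight_one, ← mulRight_one, ← mulRight_tensor, ← mulRight_tensor]
  exact mulRight_add _ _

lemma mulRight_counit (v : 𝟙_ (Wires ax) ⟶ wire ax) :
    mulRight v ≫ ε[wire ax] = ε[wire ax] ≫ v ≫ ε[wire ax] := by
  rw [mulRight, Category.assoc, Category.assoc, BimonObj.mul_counit, Comon.tensorObj_counit,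
    rightUnitor_inv_whiskerLeft_tensorHom]

lemma mulRight_annih (v : 𝟙_ (Wires _) ⟶ wire _) : mulRight v ≫ annih @QPathAxiom
    = annih _ ≫ v ≫ ε[wire _] + ε[wire _] ≫ v ≫ annih _ := by
  rw [mulRight, Category.assoc, Category.assoc, mul_annih, Preadditive.comp_add,
    Preadditive.comp_add, rightUnitor_inv_whiskerLeft_tensorHom,
    rightUnitor_inv_whiskerLeft_tensorHom]

lemma prep_scale_counit (s : ℂ) : prep @QPathAxiom ≫ scale _ s ≫ ε[wire _] = 0 := by
  rw [IsComonHom.hom_counit, prep_counit]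

lemma preps_matrixWires_succ (p q : ℕ) (M : Fin (p + 1) → Fin q → ℂ) :
    preps ax (p + 1) ≫ matrixWires ax (p + 1) q M
      = preps ax p ≫ matrixWires ax p q (fun i => M i.castSucc) ≫
          mulRight (prep ax ≫ row ax q (M (Fin.last p))) := by
  rw [preps_succ, matrixWires_succ, Category.assoc, tensorHom_comp_tensorHom_assoc,
    leftUnitor_inv_tensorHom_mul, Category.assoc]

end Branching

/-- The linear combinations of the effects that annihilate one photon on some of the wires and
discard the others. -/
inductive MultilinearEffect : {q : ℕ} → (bundle @QPathAxiom q ⟶ 𝟙_ (Wires _)) → Prop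
  | id : MultilinearEffect (q := 0) (𝟙 (𝟙_ (Wires _)))
  | annih {q : ℕ} {e : bundle _ q ⟶ 𝟙_ (Wires _)} (he : MultilinearEffect e) :
      MultilinearEffect (q := q + 1) ((e ⊗ₘ annih _) ≫ (λ_ (𝟙_ (Wires _))).hom)
  | counit {q : ℕ} {e : bundle _ q ⟶ 𝟙_ (Wires _)} (he : MultilinearEffect e) :
      MultilinearEffect (q := q + 1) ((e ⊗ₘ ε[wire _]) ≫ (λ_ (𝟙_ (Wires _))).hom)
  | add {q : ℕ} {e e' : bundle _ q ⟶ 𝟙_ (Wires _)} (he : MultilinearEffect e)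
      (he' : MultilinearEffect e') : MultilinearEffect (e + e')
  | smul {q : ℕ} {e : bundle _ q ⟶ 𝟙_ (Wires _)} (c : ℂ) (he : MultilinearEffect e) :
      MultilinearEffect (c • e)

namespace MultilinearEffect

lemma annihs (q : ℕ) : MultilinearEffect (annihs _ q) := by
  induction q with
  | zero => exact id
  | succ q ih =>
    rw [annihs_succ]
    exact ih.annih

lemma mulRight_prep_row_comp {q : ℕ} {e : bundle _ q ⟶ 𝟙_ (Wires _)} (he : MultilinearEffect e)
    (r : Fin q → ℂ) : MultilinearEffect (mulRight (prep _ ≫ row _ q r) ≫ e) := by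
  induction he with
  | id =>
    rw [mulRight_prep_row_zero, Limits.zero_comp, ← zero_smul ℂ (𝟙 (𝟙_ (Wires @QPathAxiom)))]
    exact id.smul 0
  | @annih q e he ih =>
    rw [mulRight_prep_row_succ, Preadditive.add_comp, tensorHom_comp_tensorHom_assoc,
      tensorHom_comp_tensorHom_assoc, Category.id_comp, Category.id_comp,
      mulRight_annih, Category.assoc, Category.assoc, prep_scale_counit, prep_scale_annih,
      Limits.comp_zero, zero_add, Linear.comp_smul, Category.comp_id,
      MonoidalCategory.tensorHom_def e, MonoidalLinear.whiskerLeft_smul, Linear.comp_smul,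
      Linear.smul_comp, ← MonoidalCategory.tensorHom_def]
    exact (ih _).annih.add (he.counit.smul _)
  | counit _ ih =>
    rw [mulRight_prep_row_succ, Preadditive.add_comp, tensorHom_comp_tensorHom_assoc,
      tensorHom_comp_tensorHom_assoc, Category.id_comp, Category.id_comp,
      mulRight_counit, Category.assoc, prep_scale_counit, Limits.comp_zero,
      MonoidalPreadditive.tensor_zero, Limits.zero_comp, add_zero]
    exact (ih _).counit
  | add _ _ ih ih' =>
    rw [Preadditive.comp_add]
    exact (ih r).add (ih' r)
  | smul c _ ih =>
    rw [Linear.comp_smul]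
    exact (ih r).smul c

lemma exists_one_comp_eq_smul {q : ℕ} {e : bundle _ q ⟶ 𝟙_ (Wires _)}
    (he : MultilinearEffect e) : ∃ c : ℂ, η[bundle _ q] ≫ e = c • 𝟙 (𝟙_ (Wires _)) := by
  induction he with
  | id => exact ⟨1, by rw [one_smul]; exact Category.id_comp _⟩
  | annih =>
    refine ⟨0, ?_⟩
    rw [one_bundle_succ, Category.assoc, tensorHom_comp_tensorHom_assoc, one_annih,
      MonoidalPreadditive.tensor_zero, Limits.zero_comp, Limits.comp_zero, zero_smul]
  | counit _ ih =>
    obtain ⟨c, one_comp⟩ := ih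
    refine ⟨c, ?_⟩
    rw [one_bundle_succ, Category.assoc, tensorHom_comp_tensorHom_assoc, BimonObj.one_counit,
      one_comp, tensorHom_id, MonoidalLinear.smul_whiskerRight, id_whiskerRight, Linear.smul_comp,
      Linear.comp_smul, Category.id_comp, Iso.inv_hom_id]
  | add _ _ ih ih' =>
    obtain ⟨c, one_comp⟩ := ih
    obtain ⟨c', one_comp'⟩ := ih'
    exact ⟨c + c', by rw [Preadditive.comp_add, one_comp, one_comp', add_smul]⟩
  | smul c _ ih =>
    obtain ⟨c', one_comp⟩ := ih
    exact ⟨c * c', by rw [Linear.comp_smul, one_comp, smul_smul]⟩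

lemma exists_preps_matrixWires_comp_eq_smul {q : ℕ} {e : bundle _ q ⟶ 𝟙_ (Wires _)}
    (he : MultilinearEffect e) (p : ℕ) (M : Fin p → Fin q → ℂ) :
    ∃ c : ℂ, preps _ p ≫ matrixWires _ p q M ≫ e = c • 𝟙 (𝟙_ (Wires _)) := by
  induction p generalizing e with
  | zero =>
    rw [matrixWires_zero]
    obtain ⟨c, one_comp⟩ := he.exists_one_comp_eq_smul
    exact ⟨c, by rw [one_comp]; exact Category.id_comp _⟩
  | succ p ih =>
    obtain ⟨c, hc⟩ := ih (he.mulRight_prep_row_comp (M (Fin.last p))) fun i => M i.castSucc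
    refine ⟨c, ?_⟩
    rw [← hc, ← Category.assoc, preps_matrixWires_succ, Category.assoc, Category.assoc]

end MultilinearEffect

lemma exists_rewrites_smul_idn (d : Diag 0 0) :
    ∃ c : ℂ, Rewrites @QPathAxiom (Lin.of d) (c • Lin.of (idn 0)) := by
  obtain ⟨p, q, M, normalForm⟩ := exists_isNormalForm_ofMatrix d
  obtain ⟨c, eq_smul⟩ :=
    (MultilinearEffect.annihs q).exists_preps_matrixWires_comp_eq_smul p M
  refine ⟨d.normFactor * c, (normalForm.mono .norm).trans ?_⟩
  rw [mul_smul]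
  refine .smul _ (Cls.ofLin_eq_iff.mp ?_)
  rw [map_smul]
  exact (arrow_diagram_ofMatrix M).trans eq_smul

lemma exists_lin_rewrites_smul_idn (x : Lin 0 0) :
    ∃ c : ℂ, Rewrites @QPathAxiom x (c • Lin.of (idn 0)) := by
  induction x using Finsupp.induction_linear with
  | zero => exact ⟨0, by rw [zero_smul]; exact .refl 0⟩
  | add x y hx hy =>
    obtain ⟨c, hc⟩ := hx
    obtain ⟨c', hc'⟩ := hy
    exact ⟨c + c', by rw [add_smul]; exact hc.add hc'⟩
  | single d a =>
    obtain ⟨c, hc⟩ := exists_rewrites_smul_idn d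
    refine ⟨a * c, ?_⟩
    rw [mul_smul, ← Finsupp.smul_single_one]
    exact hc.smul a

lemma smul_idn_injective {c c' : ℂ}
    (h : bosonicLin (c • Lin.of (idn 0)) = bosonicLin (c' • Lin.of (idn 0))) : c = c' := by
  have vacuum_amplitude := congrArg (fun f : Fock 0 →ₗ[ℂ] Fock 0 => f (ket ![]) ![]) h
  simpa [bosonicLin_of, bosonic, ket] using vacuum_amplitude

theorem rewrites_of_bosonicLin_eq {x y : Lin 0 0} (h : bosonicLin x = bosonicLin y) :
    Rewrites @QPathAxiom x y := by
  obtain ⟨c, hx⟩ := exists_lin_rewrites_smul_idn x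
  obtain ⟨c', hy⟩ := exists_lin_rewrites_smul_idn y
  have bosonicLin_x := hx.sound QPathAxiom.sound
  have bosonicLin_y := hy.sound QPathAxiom.sound
  rw [smul_idn_injective (bosonicLin_x.symm.trans (h.trans bosonicLin_y))] at hx
  exact hx.trans hy.symm

end QPath

end

theorem mainTheorem2 :
    -- soundness of the rewrite rules, for all diagrams
    (∀ (m n : ℕ) (x y : QPath.Lin m n), QPath.Rewrites @QPath.QPathAxiom x y →
      QPath.bosonicLin x = QPath.bosonicLin y) ∧
    -- completeness of the rewrite rules for closed diagrams
    (∀ d d' : QPath.Diag 0 0, QPath.bosonic d = QPath.bosonic d' →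
      QPath.Rewrites @QPath.QPathAxiom (QPath.Lin.of d) (QPath.Lin.of d')) ∧
    -- completeness of the rewrite rules for formal sums of closed diagrams
    (∀ x y : QPath.Lin 0 0, QPath.bosonicLin x = QPath.bosonicLin y →
      QPath.Rewrites @QPath.QPathAxiom x y) ∧
    -- every closed diagram has a normal form
    (∀ d : QPath.Diag 0 0, ∃ (p q : ℕ) (G : QPath.WeightedBipartiteGraph p q),
      QPath.IsNormalForm d G d.normFactor) ∧
    -- the interpretation of a closed diagram is read off from any normal form
    (∀ (d : QPath.Diag 0 0) (p q : ℕ) (G : QPath.WeightedBipartiteGraph p q) (N : ℂ),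
      QPath.IsNormalForm d G N →
        QPath.amplitude d = N * G.matchingSum ∧
        (∀ e : Fin p ≃ Fin q,
          QPath.amplitude d = N * (G.adjacency.submatrix id e).permanent) ∧
        (p ≠ q → QPath.amplitude d = 0)) := by
  refine ⟨fun _ _ _ _ h => h.sound QPath.QPathAxiom.sound, fun d d' h => ?_,
    fun _ _ h => QPath.rewrites_of_bosonicLin_eq h, fun d => ?_,
    fun d p q G N h => ⟨?_, fun e => ?_, fun hpq => ?_⟩⟩
  · exact QPath.rewrites_of_bosonicLin_eq (by rwa [QPath.bosonicLin_of, QPath.bosonicLin_of])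
  · obtain ⟨p, q, M, h⟩ := QPath.exists_isNormalForm_ofMatrix d
    exact ⟨p, q, .ofMatrix M, h⟩
  · rw [h.amplitude_eq, G.matchingSum_eq_bijectionPermanent]
  · rw [h.amplitude_eq, QPath.bijectionPermanent_eq_permanent]
  · rw [h.amplitude_eq, QPath.bijectionPermanent_eq_zero _ hpq, mul_zero]
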